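/- Let $d\ge 0$ and let $\zeta=(\zeta(t))_{t\ge 0}$ be a càdlàg process with values in $\mathbb R^d$ (the intrinsic process), given by its laws $\mathbb P_z$ ("$\zeta$ given $\zeta(0)=z$"), which form a probability kernel $z\mapsto \mathbb P_z$ from $\mathbb R^d$ to the space of càdlàg paths with $\zeta(0)=z$ $\mathbb P_z$-a.s. Let $\lambda:\mathbb R^d\to\mathbb R_+$ be measurable and bounded, with $\int_0^\infty\lambda(\zeta(v))\,dv=+\infty$ $\mathbb P_z$-a.s. for every $z$, let $Q$ be a transition probability on $\mathbb R^d$, and put $$M(\zeta;dx,dv)=\lambda(\zeta(v))\,e^{-\int_0^v\lambda(\zeta(w))\,dw}\,Q(\zeta(v);dx)\,dv .$$ A switching process $\Psi$ associated with $\zeta$ and $M$, with initial law $\mu$ (for instance $\mu=\delta_{x_0}$), is a process on a probability space constructed as follows. The variable $Y_0$ has law $\mu$, and $T_0=0$. For $n\ge 0$, given $\zeta^{(1)},\dots,\zeta^{(n)},(Y_0,T_0),\dots,(Y_n,T_n)$, the path $\zeta^{(n+1)}$ has law $\mathbb P_{Y_n}$. Given these variables and $\zeta^{(n+1)}$, the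 pair $(Y_{n+1},T_{n+1}-T_n)$ has law $M(\zeta^{(n+1)};dx,dv)$. Finally, almost surely, $\Psi_t=\zeta^{(n+1)}(t-T_n)$ for $T_n\le t<T_{n+1}$, and $\Psi_{T_{n+1}}=Y_{n+1}$. Let $\mathcal A_0$ be an operator with domain $\mathcal D(\mathcal A_0)$, acting on measurable real functions on $\mathbb R_+\times\mathbb R^d$ that are bounded on $[0,t]\times\mathbb R^d$ for every $t>0$. Suppose that for every $g\in\mathcal D(\mathcal A_0)$: 1. for every $z$, the process $$M^g_t=g(t,\zeta(t))-g(0,\zeta(0))-\int_0^t\mathcal A_0g(v,\zeta(v))\,dv$$ is a martingale under $\mathbb P_z$ for the natural filtration of $\zeta$; 2. $\mathcal A_0g$ is measurable, and bounded on $[0,t]\times\mathbb R^d$ for every $t>0$. Write $\tau_sg(v,z)=g(s+v,z)$. Let $g\in\mathcal D(\mathcal A_0)$ be such that $\tau_sg\in\mathcal D(\mathcal A_0)$ and $\mathcal A_0\tau_sg=\tau_s\mathcal A_0g$ for every $s>0$, and put $$\tilde{\mathcal A}_0g(v,z)=\mathcal A_0g(v,z)+\lambda(z)\int_{\mathbb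 R^d}\bigl(g(v,z_1)-g(v,z)\bigr)\,Q(z;dz_1).$$ Then $g(t,\Psi_t)$ and $\tilde{\mathcal A}_0g(t,\Psi_t)$ are integrable for every $t\ge 0$, the function $s\mapsto\mathbb E(\tilde{\mathcal A}_0g(s,\Psi_s))$ is integrable on $[0,t]$, and $$\mathbb E\bigl(g(t,\Psi_t)\bigr)=\mathbb E\bigl(g(0,\Psi_0)\bigr)+\int_0^t\mathbb E\bigl(\tilde{\mathcal A}_0g(s,\Psi_s)\bigr)\,ds\qquad\text{for every }t\ge 0 .$$ -/

import Mathlib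

open MeasureTheory ProbabilityTheory Filter Topology
open scoped NNReal ENNReal

/-- Lebesgue measure on the time axis `[0, ∞)`. -/
noncomputable def leb : Measure ℝ≥0 :=
  ((volume : Measure ℝ).restrict (Set.Ici 0)).map Real.toNNReal

noncomputable instance instSFiniteLeb : SFinite leb := by
  unfold leb; infer_instance

/-- The state space `ℝᵈ`. -/
abbrev State (d : ℕ) : Type := EuclideanSpace ℝ (Fin d)

/-- Right-continuous functions on `[0, ∞)` with left limits. -/
def IsCadlag {E : Type*} [TopologicalSpace E] (f : ℝ≥0 → E) : Prop :=
  ∀ t, ContinuousWithinAt f (Set.Ici t) t ∧ ∃ l, Tendsto f (𝓝[<] t) (𝓝 l)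

/-- The space of càdlàg paths in `ℝᵈ`, with the σ-algebra generated by the coordinate maps. -/
abbrev CadlagPath (d : ℕ) : Type := {f : ℝ≥0 → State d // IsCadlag f}

theorem measurable_coord {d : ℕ} (t : ℝ≥0) : Measurable (fun ω : CadlagPath d => ω.1 t) :=
  (measurable_pi_apply t).comp measurable_subtype_coe

/-- The evaluation `(ω, t) ↦ ω(t)` is jointly measurable on càdlàg paths. -/
theorem measurable_eval {d : ℕ} : Measurable (fun p : CadlagPath d × ℝ≥0 => p.1.1 p.2) := by
  let r : ℕ → ℝ≥0 → ℝ≥0 := fun n t => ((⌊((n : ℝ≥0) + 1) * t⌋₊ : ℝ≥0) + 1) / ((n : ℝ≥0) + 1)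
  have hlt : ∀ n t, t < r n t := by
    intro n t
    have h := Nat.lt_floor_add_one (((n : ℝ≥0) + 1) * t)
    rw [lt_div_iff₀ (by positivity)]
    rwa [mul_comm t]
  have hle : ∀ n t, r n t ≤ t + 1 / ((n : ℝ≥0) + 1) := by
    intro n t
    have h := Nat.floor_le (a := ((n : ℝ≥0) + 1) * t) zero_le
    have hn : ((n : ℝ≥0) + 1) ≠ 0 := by positivity
    have h' : (t + 1 / ((n : ℝ≥0) + 1)) * ((n : ℝ≥0) + 1) = ((n : ℝ≥0) + 1) * t + 1 := by
      field_simp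
    rw [div_le_iff₀ (by positivity), h']
    gcongr
  have hr : ∀ t, Tendsto (fun n => r n t) atTop (𝓝[≥] t) := by
    intro t
    refine tendsto_nhdsWithin_iff.2 ⟨?_, Eventually.of_forall fun n => (hlt n t).le⟩
    refine tendsto_of_tendsto_of_tendsto_of_le_of_le tendsto_const_nhds ?_
      (fun n => (hlt n t).le) (fun n => hle n t)
    have h := (tendsto_const_nhds (x := t)).add (tendsto_one_div_add_atTop_nhds_zero_nat (𝕜 := ℝ≥0))
    simpa using h
  refine measurable_of_tendsto_metrizable
    (f := fun n (p : CadlagPath d × ℝ≥0) => p.1.1 (r n p.2)) (fun n => ?_) ?_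
  · have h1 : Measurable (fun q : CadlagPath d × ℕ =>
        q.1.1 (((q.2 : ℝ≥0) + 1) / ((n : ℝ≥0) + 1))) :=
      measurable_from_prod_countable_left fun k => measurable_coord (((k : ℝ≥0) + 1) / ((n : ℝ≥0) + 1))
    have h2 : Measurable (fun p : CadlagPath d × ℝ≥0 => (p.1, ⌊((n : ℝ≥0) + 1) * p.2⌋₊)) :=
      measurable_fst.prodMk (Nat.measurable_floor.comp (measurable_snd.const_mul _))
    exact h1.comp h2
  · refine tendsto_pi_nhds.2 fun p => ?_
    exact (p.1.2 p.2).1.tendsto.comp (hr p.2)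

/-- The natural filtration of the coordinate process on path space. -/
noncomputable def pathFiltration (d : ℕ) :
    Filtration ℝ≥0 (Subtype.instMeasurableSpace : MeasurableSpace (CadlagPath d)) :=
  Filtration.natural (fun t (ω : CadlagPath d) => ω.1 t)
    (fun t => (measurable_coord t).stronglyMeasurable)

/-- The cumulated jump rate `∫₀ᵛ λ(ζ(w)) dw` along a path `ζ`. -/
noncomputable def hazard {d : ℕ} (lam : State d → ℝ≥0) (ζ : CadlagPath d) (v : ℝ≥0) : ℝ :=
  ∫ w in Set.Iic v, (lam (ζ.1 w) : ℝ) ∂leb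

/-- The density `λ(ζ(v)) exp (-∫₀ᵛ λ(ζ(w)) dw)` of the jump time along a path `ζ`. -/
noncomputable def jumpDensity {d : ℕ} (lam : State d → ℝ≥0) (ζ : CadlagPath d) (v : ℝ≥0) : ℝ≥0∞ :=
  ENNReal.ofReal ((lam (ζ.1 v) : ℝ) * Real.exp (-hazard lam ζ v))

theorem measurable_jumpDensity {d : ℕ} {lam : State d → ℝ≥0} (hlam : Measurable lam) :
    Measurable (Function.uncurry (jumpDensity lam)) := by
  have h1 : Measurable (fun p : CadlagPath d × ℝ≥0 => (lam (p.1.1 p.2) : ℝ)) :=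
    (hlam.comp measurable_eval).coe_nnreal_real
  have h2 : Measurable (fun p : CadlagPath d × ℝ≥0 => hazard lam p.1 p.2) := by
    have h3 : StronglyMeasurable (fun q : (CadlagPath d × ℝ≥0) × ℝ≥0 =>
        (Set.indicator {q : (CadlagPath d × ℝ≥0) × ℝ≥0 | q.2 ≤ q.1.2}
          (fun q => (lam (q.1.1.1 q.2) : ℝ))) q) := by
      refine (Measurable.indicator ?_ ?_).stronglyMeasurable
      · exact h1.comp ((measurable_fst.comp measurable_fst).prodMk measurable_snd)
      · exact measurableSet_le measurable_snd (measurable_snd.comp measurable_fst)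
    have h4 := (h3.integral_prod_right' (ν := leb)).measurable
    refine (congrArg Measurable (funext fun p => ?_)).mp h4
    rw [hazard, ← integral_indicator measurableSet_Iic]
    rfl
  exact (h1.mul h2.neg.exp).ennreal_ofReal

/-- The kernel
`M(ζ; dx, dv) = λ(ζ(v)) exp (-∫₀ᵛ λ(ζ(w)) dw) Q(ζ(v); dx) dv` from paths to `ℝᵈ × [0, ∞)`. -/
noncomputable def jumpKernel {d : ℕ} (lam : State d → ℝ≥0) (Q : Kernel (State d) (State d)) :
    Kernel (CadlagPath d) (State d × ℝ≥0) :=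
  ((Kernel.withDensity (Kernel.const (CadlagPath d) leb) (jumpDensity lam)) ⊗ₖ
    (Q.comap (fun p : CadlagPath d × ℝ≥0 => p.1.1 p.2) measurable_eval)).map Prod.swap

instance instSFiniteJumpKernel {d : ℕ} (lam : State d → ℝ≥0) (Q : Kernel (State d) (State d)) :
    IsSFiniteKernel (jumpKernel lam Q) := by
  have : IsSFiniteKernel
      (Kernel.withDensity (Kernel.const (CadlagPath d) leb) (jumpDensity lam)) :=
    Kernel.IsSFiniteKernel.withDensity _ fun _ _ => ENNReal.ofReal_ne_top
  unfold jumpKernel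
  infer_instance

/-- The kernel `jumpKernel` integrates functions as the displayed formula for `M` says. -/
theorem lintegral_jumpKernel {d : ℕ} {lam : State d → ℝ≥0} (hlam : Measurable lam)
    (Q : Kernel (State d) (State d)) [IsSFiniteKernel Q] (ζ : CadlagPath d)
    {φ : State d × ℝ≥0 → ℝ≥0∞} (hφ : Measurable φ) :
    ∫⁻ q, φ q ∂(jumpKernel lam Q ζ)
      = ∫⁻ v, jumpDensity lam ζ v * ∫⁻ x, φ (x, v) ∂(Q (ζ.1 v)) ∂leb := by
  have hM := measurable_jumpDensity hlam
  have hs : IsSFiniteKernel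
      (Kernel.withDensity (Kernel.const (CadlagPath d) leb) (jumpDensity lam)) :=
    Kernel.IsSFiniteKernel.withDensity _ fun _ _ => ENNReal.ofReal_ne_top
  have hφ' : Measurable (fun p : ℝ≥0 × State d => φ p.swap) := hφ.comp measurable_swap
  have hin : Measurable (fun v : ℝ≥0 => ∫⁻ x, φ (x, v) ∂(Q (ζ.1 v))) := by
    have := hφ'.lintegral_kernel_prod_right'
      (κ := Q.comap (fun v : ℝ≥0 => ζ.1 v) (measurable_eval.comp measurable_prodMk_left))
    simpa using this
  rw [jumpKernel, Kernel.lintegral_map _ measurable_swap _ hφ,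
    Kernel.lintegral_compProd _ _ _ hφ', Kernel.lintegral_withDensity _ hM]
  · simp [Prod.swap]
  · simpa using hin

/-- What is known when the `(n+1)`-st path is drawn: the first `n` paths, and the pairs
`(Y₀, T₀), …, (Yₙ, Tₙ)`. -/
abbrev History (d n : ℕ) : Type := (Fin n → CadlagPath d) × (Fin (n + 1) → State d × ℝ≥0)

/-- The current history of a construction `(ζ, Y, T)`. -/
def history {d : ℕ} {Ω : Type*} (ζ : ℕ → Ω → CadlagPath d) (Y : ℕ → Ω → State d)
    (T : ℕ → Ω → ℝ≥0) (n : ℕ) (ω : Ω) : History d n :=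
  (fun k => ζ k ω, fun k => (Y k ω, T k ω))

theorem measurable_lastState {d n : ℕ} :
    Measurable (fun h : History d n => (h.2 (Fin.last n)).1) :=
  ((measurable_pi_apply (Fin.last n)).comp measurable_snd).fst

/-- `(ζ, Y, T)` constructs the switching process `X` with initial law `μ`, where `P z` is the law of
the intrinsic process started from `z`. The path `ζ n` drives `X` on `[Tₙ, Tₙ₊₁)`; a deterministic
initial state `x₀` is the case `μ = δ_{x₀}`. -/
structure IsSwitchingConstruction {d : ℕ} {Ω : Type*} [MeasurableSpace Ω]
    (P : Kernel (State d) (CadlagPath d)) (lam : State d → ℝ≥0) (Q : Kernel (State d) (State d))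
    (μ : Measure (State d)) (Pr : Measure Ω)
    (ζ : ℕ → Ω → CadlagPath d) (Y : ℕ → Ω → State d) (T : ℕ → Ω → ℝ≥0)
    (X : ℝ≥0 → Ω → State d) : Prop where
  measurable_path : ∀ n, Measurable (ζ n)
  measurable_state : ∀ n, Measurable (Y n)
  measurable_time : ∀ n, Measurable (T n)
  initial_state : HasLaw (Y 0) μ Pr
  initial_time : ∀ᵐ ω ∂Pr, T 0 ω = 0
  time_le : ∀ᵐ ω ∂Pr, ∀ n, T n ω ≤ T (n + 1) ω
  /-- Given the past, `ζ n` has the law of the intrinsic process started from `Yₙ`. -/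
  law_path : ∀ n, HasCondDistrib (ζ n) (history ζ Y T n)
    (P.comap (fun h : History d n => (h.2 (Fin.last n)).1) measurable_lastState) Pr
  /-- Given the past and `ζ n`, the pair `(Yₙ₊₁, Tₙ₊₁ - Tₙ)` has law `M(ζ n; dx, dv)`. -/
  law_jump : ∀ n, HasCondDistrib (fun ω => (Y (n + 1) ω, T (n + 1) ω - T n ω))
    (fun ω => (history ζ Y T n ω, ζ n ω))
    (Kernel.prodMkLeft (History d n) (jumpKernel lam Q)) Pr
  between_jumps : ∀ᵐ ω ∂Pr, ∀ n t, T n ω ≤ t → t < T (n + 1) ω → X t ω = (ζ n ω).1 (t - T n ω)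
  at_jumps : ∀ᵐ ω ∂Pr, ∀ n, X (T (n + 1) ω) ω = Y (n + 1) ω

/-- `X` is a switching process with intrinsic laws `P`, jump rate `lam`, jump kernel `Q` and
initial law `μ`. -/
def IsSwitchingProcess {d : ℕ} {Ω : Type*} [MeasurableSpace Ω]
    (P : Kernel (State d) (CadlagPath d)) (lam : State d → ℝ≥0) (Q : Kernel (State d) (State d))
    (μ : Measure (State d)) (X : ℝ≥0 → Ω → State d) (Pr : Measure Ω) : Prop :=
  ∃ ζ Y T, IsSwitchingConstruction P lam Q μ Pr ζ Y T X

/-- `g` is bounded on `[0, t] × ℝᵈ` for every `t`. -/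
def BoundedOnStrips {d : ℕ} (g : ℝ≥0 → State d → ℝ) : Prop :=
  ∀ t : ℝ≥0, ∃ C : ℝ, ∀ s ≤ t, ∀ z, |g s z| ≤ C

/-- The time shift `(τ_s g)(v, z) = g(s + v, z)`. -/
def timeShift {d : ℕ} (s : ℝ≥0) (g : ℝ≥0 → State d → ℝ) : ℝ≥0 → State d → ℝ :=
  fun v z => g (s + v) z

/-- `M^g_t = g(t, ζ(t)) - g(0, ζ(0)) - ∫₀ᵗ a(v, ζ(v)) dv`. -/
noncomputable def compensated {d : ℕ} (g a : ℝ≥0 → State d → ℝ) (t : ℝ≥0) (ζ : CadlagPath d) : ℝ :=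
  g t (ζ.1 t) - g 0 (ζ.1 0) - ∫ v in Set.Iic t, a v (ζ.1 v) ∂leb

/-- `(v, z) ↦ a(v, z) + λ(z) ∫ (g(v, z₁) - g(v, z)) Q(z; dz₁)`. -/
noncomputable def switchedGenerator {d : ℕ} (lam : State d → ℝ≥0) (Q : Kernel (State d) (State d))
    (g a : ℝ≥0 → State d → ℝ) (v : ℝ≥0) (z : State d) : ℝ :=
  a v z + (lam z : ℝ) * ∫ z₁, (g v z₁ - g v z) ∂(Q z)

/-! The proof decomposes the trajectory at its jump times. Write `S v` for `survival`, `D v =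
λ(ζ(v)) S v` for `killRate` (the density of the waiting time along `ζ`), `N` for the martingale
`compensated h a`, and `G` for the switched generator.

For one excursion, integration by parts along a fixed path writes `S r * h(r, ζ(r))` as `h(0, ζ(0))
+ ∫ S (a - λ h) + S r * N r + ∫ D N`, the integrals running over `[0, r]`. Since `S r = 1 - ∫ D` and
`D v` depends only on the path up to time `v`, the martingale property gives `E[D v * N r] = E[D v *
N v]`, and the last two terms have mean zero. This is `integral_survival_mul`. Averaging over the
jump adds `∫ D Qh`, which cancels the gain term `λ Qh` of `G`. Hence the value of `h` at the first
jump or at the horizon, minus the integral of `G` until then, has mean `h(0, z)`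
(`integral_jumpIncrement`).

Given the state and time `(Yₙ, Tₙ)` with `Tₙ ≤ t`, the same formula applies to the functions shifted
by `Tₙ`, with horizon `t - Tₙ` (`IsSwitchingConstruction.integral_stepValue`). Along a trajectory
these increments telescope (`sum_stepValue_eq`). As `λ` is bounded, the jump times tend to infinity
(`IsSwitchingConstruction.tendsto_time`), and dominated convergence gives the formula at `t`; Fubini
then exchanges expectation and time integral. -/

/-! ### Lebesgue measure on the half-line: intervals, translations, exponentials. -/

theorem leb_apply {s : Set ℝ≥0} (hs : MeasurableSet s) :
    leb s = volume (Real.toNNReal ⁻¹' s ∩ Set.Ici 0) := by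
  rw [leb, Measure.map_apply measurable_real_toNNReal hs,
    Measure.restrict_apply (measurable_real_toNNReal hs)]

theorem leb_Iic (t : ℝ≥0) : leb (Set.Iic t) = t := by
  rw [leb_apply measurableSet_Iic]
  have : Real.toNNReal ⁻¹' Set.Iic t ∩ Set.Ici 0 = Set.Icc 0 (t : ℝ) := by
    ext x
    simp only [Set.mem_inter_iff, Set.mem_preimage, Set.mem_Iic, Set.mem_Ici, Set.mem_Icc,
      Real.toNNReal_le_iff_le_coe]
    tauto
  rw [this, Real.volume_Icc, sub_zero, ENNReal.ofReal_coe_nnreal]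

instance isFiniteMeasure_leb_Iic (t : ℝ≥0) : IsFiniteMeasure (leb.restrict (Set.Iic t)) :=
  ⟨by simp [leb_Iic]⟩

/-- Transfers integrals to the real line, where the fundamental theorem of calculus is available. -/
theorem setIntegral_Iic_leb (r : ℝ≥0) {f : ℝ≥0 → ℝ} (hf : Measurable f) :
    ∫ v in Set.Iic r, f v ∂leb = ∫ x in (0 : ℝ)..r, f x.toNNReal := by
  rw [leb, setIntegral_map measurableSet_Iic hf.aestronglyMeasurable
    measurable_real_toNNReal.aemeasurable,
    Measure.restrict_restrict (measurable_real_toNNReal measurableSet_Iic),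
    intervalIntegral.integral_of_le r.coe_nonneg, ← integral_Icc_eq_integral_Ioc]
  congr 2
  ext x
  simp only [Set.mem_inter_iff, Set.mem_preimage, Set.mem_Iic, Set.mem_Ici, Set.mem_Icc,
    Real.toNNReal_le_iff_le_coe]
  tauto

theorem map_add_left_leb (s : ℝ≥0) : leb.map (fun v => s + v) = leb.restrict (Set.Ici s) := by
  ext A hA
  have hm : Measurable (fun v : ℝ≥0 => s + v) := measurable_const_add s
  rw [Measure.map_apply hm hA, Measure.restrict_apply hA, leb_apply (hm hA),
    leb_apply (hA.inter measurableSet_Ici),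
    ← measure_preimage_add volume (s : ℝ) (Real.toNNReal ⁻¹' (A ∩ Set.Ici s) ∩ Set.Ici 0)]
  congr 1
  ext x
  simp only [Set.mem_inter_iff, Set.mem_preimage, Set.mem_Ici]
  constructor
  · rintro ⟨h1, h2⟩
    rw [Real.toNNReal_add s.coe_nonneg h2, Real.toNNReal_coe]
    exact ⟨⟨h1, le_self_add⟩, add_nonneg s.coe_nonneg h2⟩
  · rintro ⟨⟨h1, h2⟩, h3⟩
    have h4 : 0 ≤ x := by
      rw [Real.le_toNNReal_iff_coe_le h3] at h2
      linarith
    rw [Real.toNNReal_add s.coe_nonneg h4, Real.toNNReal_coe] at h1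
    exact ⟨h1, h4⟩

/-- Translation of an integral over `[s₀, s₁) ∩ [0, t]` to the origin. -/
theorem setIntegral_Iic_leb_translate {s₀ s₁ t : ℝ≥0} (f : ℝ≥0 → ℝ)
    (ht : s₀ ≤ t) :
    ∫ s in Set.Iic t, (Set.Ico s₀ s₁).indicator f s ∂leb
      = ∫ w in Set.Iic (t - s₀), (Set.Iio (s₁ - s₀)).indicator (fun w => f (s₀ + w)) w ∂leb := by
  -- A translation of the half-line is a closed embedding, so the change of variables needs no
  -- measurability of `f`.
  have hi : Isometry (fun v : ℝ≥0 => s₀ + v) := Isometry.of_dist_eq fun x y => by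
    simp [NNReal.dist_eq]
  have he : MeasurableEmbedding (fun v : ℝ≥0 => s₀ + v) := hi.isClosedEmbedding.measurableEmbedding
  have h1 : ∫ s in Set.Iic t, (Set.Ico s₀ s₁).indicator f s ∂leb
      = ∫ s in Set.Iic t, (Set.Iio s₁).indicator f s ∂(leb.restrict (Set.Ici s₀)) := by
    rw [Measure.restrict_restrict measurableSet_Iic, Set.inter_comm, ← Measure.restrict_restrict
      measurableSet_Ici, ← integral_indicator measurableSet_Ici, Set.indicator_indicator]
    rfl
  rw [h1, ← map_add_left_leb, he.setIntegral_map]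
  congr 1
  · congr 2
    ext x
    simp [le_tsub_iff_left ht]
  · ext x
    simp [Set.indicator, lt_tsub_iff_left]

theorem lintegral_exp_neg_mul_leb {θ : ℝ} (hθ : 0 < θ) :
    ∫⁻ v, ENNReal.ofReal (Real.exp (-θ * v)) ∂leb = ENNReal.ofReal θ⁻¹ := by
  rw [leb, lintegral_map (by fun_prop) measurable_real_toNNReal,
    Measure.restrict_congr_set Ioi_ae_eq_Ici.symm]
  have h1 : ∀ x ∈ Set.Ioi (0 : ℝ), ENNReal.ofReal (Real.exp (-θ * (x.toNNReal : ℝ)))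
      = ENNReal.ofReal (Real.exp (-θ * x)) := fun x hx => by
    rw [Real.coe_toNNReal _ (le_of_lt hx)]
  rw [setLIntegral_congr_fun measurableSet_Ioi h1,
    ← ofReal_integral_eq_lintegral_ofReal (integrableOn_exp_mul_Ioi (by linarith) 0)
      (ae_of_all _ fun x => (Real.exp_pos _).le),
    integral_exp_mul_Ioi (by linarith)]
  simp

/-! ### The survival function along a path and the total mass of the jump density. -/

section Survival

/-- Makes `e^{-∫f}` Lipschitz in its upper limit when `f` is bounded and nonnegative. -/
theorem abs_exp_neg_sub_exp_neg_le {a b : ℝ} (ha : 0 ≤ a) (hb : 0 ≤ b) :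
    |Real.exp (-a) - Real.exp (-b)| ≤ |a - b| := by
  have key : ∀ {a b : ℝ}, 0 ≤ a → a ≤ b → |Real.exp (-a) - Real.exp (-b)| ≤ |a - b| := by
    intro a b ha hab
    have h1 : Real.exp (-b) ≤ Real.exp (-a) := Real.exp_le_exp.2 (by linarith)
    rw [abs_of_nonneg (by linarith), abs_of_nonpos (by linarith)]
    have h2 : Real.exp (-b) = Real.exp (-a) * Real.exp (a - b) := by
      rw [← Real.exp_add]; congr 1; ring
    have h3 := Real.add_one_le_exp (a - b)
    have h4 : Real.exp (-a) ≤ 1 := Real.exp_le_one_iff.2 (by linarith)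
    have h5 := Real.exp_pos (-a)
    rw [h2]
    nlinarith
  rcases le_total a b with h | h
  · exact key ha h
  · rw [abs_sub_comm, abs_sub_comm a b]
    exact key hb h

/-- `∫₀ʳ f e^{-∫₀ˣ f} dx = 1 - e^{-∫₀ʳ f}` for a bounded measurable function `f ≥ 0`. -/
theorem integral_mul_exp_neg_integral {f : ℝ → ℝ} (hf : Measurable f) {C : ℝ≥0}
    (h0 : ∀ x, 0 ≤ f x) (hC : ∀ x, f x ≤ C) {r : ℝ} (hr : 0 ≤ r) :
    ∫ x in (0 : ℝ)..r, f x * Real.exp (-∫ y in (0 : ℝ)..x, f y)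
      = 1 - Real.exp (-∫ y in (0 : ℝ)..r, f y) := by
  have hli : LocallyIntegrable f volume := by
    refine (locallyIntegrable_const (C : ℝ)).mono hf.aestronglyMeasurable (ae_of_all _ fun x => ?_)
    rw [Real.norm_of_nonneg (h0 x), Real.norm_of_nonneg C.coe_nonneg]
    exact hC x
  have hint : ∀ a b, IntervalIntegrable f volume a b := fun a b =>
    intervalIntegrable_iff.2
      ((hli.integrableOn_isCompact isCompact_uIcc).mono_set Set.uIoc_subset_uIcc)
  have hlip : LipschitzOnWith C (fun x => Real.exp (-∫ y in (0 : ℝ)..x, f y)) (Set.uIcc 0 r) := by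
    refine LipschitzOnWith.of_dist_le_mul fun x hx y hy => ?_
    rw [Set.uIcc_of_le hr] at hx hy
    rw [Real.dist_eq, Real.dist_eq]
    refine (abs_exp_neg_sub_exp_neg_le (intervalIntegral.integral_nonneg hx.1 fun u _ => h0 u)
      (intervalIntegral.integral_nonneg hy.1 fun u _ => h0 u)).trans ?_
    rw [intervalIntegral.integral_interval_sub_left (hint _ _) (hint _ _), ← Real.norm_eq_abs]
    refine intervalIntegral.norm_integral_le_of_norm_le_const fun u _ => ?_
    rw [Real.norm_of_nonneg (h0 u)]
    exact hC u
  -- `f` is merely measurable, so the chain rule holds only almost everywhere, by Lebesgue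
  -- differentiation. Lipschitz continuity gives absolute continuity, hence the fundamental theorem
  -- still applies.
  have h1 := hlip.absolutelyContinuousOnInterval.integral_deriv_eq_sub
  have h2 : ∫ x in (0 : ℝ)..r, f x * Real.exp (-∫ y in (0 : ℝ)..x, f y)
      = ∫ x in (0 : ℝ)..r, -deriv (fun x => Real.exp (-∫ y in (0 : ℝ)..x, f y)) x := by
    refine intervalIntegral.integral_congr_ae ?_
    filter_upwards [LocallyIntegrable.ae_hasDerivAt_integral hli] with x hx _
    rw [((hx 0).fun_neg.exp).deriv]
    ring
  rw [h2, intervalIntegral.integral_neg, h1]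
  simp

variable {d : ℕ}

theorem measurable_path (ζ : CadlagPath d) : Measurable ζ.1 :=
  measurable_eval.comp (measurable_prodMk_left (x := ζ))

theorem measurable_hazard {lam : State d → ℝ≥0} (hlam : Measurable lam) :
    Measurable (fun p : CadlagPath d × ℝ≥0 => hazard lam p.1 p.2) := by
  have h3 : StronglyMeasurable (fun q : (CadlagPath d × ℝ≥0) × ℝ≥0 =>
      (Set.indicator {q : (CadlagPath d × ℝ≥0) × ℝ≥0 | q.2 ≤ q.1.2}
        (fun q => (lam (q.1.1.1 q.2) : ℝ))) q) := by
    refine (Measurable.indicator ?_ ?_).stronglyMeasurable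
    · exact (hlam.comp measurable_eval).coe_nnreal_real.comp
        ((measurable_fst.comp measurable_fst).prodMk measurable_snd)
    · exact measurableSet_le measurable_snd (measurable_snd.comp measurable_fst)
  have h4 := (h3.integral_prod_right' (ν := leb)).measurable
  refine (congrArg Measurable (funext fun p => ?_)).mp h4
  rw [hazard, ← integral_indicator measurableSet_Iic]
  rfl

theorem hazard_nonneg (lam : State d → ℝ≥0) (ζ : CadlagPath d) (v : ℝ≥0) : 0 ≤ hazard lam ζ v :=
  integral_nonneg fun _ => NNReal.coe_nonneg _

/-- The survival probability `e^{-∫₀ᵛ λ(ζ(w)) dw}`. -/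
noncomputable def survival (lam : State d → ℝ≥0) (ζ : CadlagPath d) (v : ℝ≥0) : ℝ :=
  Real.exp (-hazard lam ζ v)

theorem measurable_survival {lam : State d → ℝ≥0} (hlam : Measurable lam) :
    Measurable (fun p : CadlagPath d × ℝ≥0 => survival lam p.1 p.2) :=
  (measurable_hazard hlam).neg.exp

theorem survival_nonneg (lam : State d → ℝ≥0) (ζ : CadlagPath d) (v : ℝ≥0) :
    0 ≤ survival lam ζ v := (Real.exp_pos _).le

theorem survival_le_one (lam : State d → ℝ≥0) (ζ : CadlagPath d) (v : ℝ≥0) :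
    survival lam ζ v ≤ 1 :=
  Real.exp_le_one_iff.2 (by linarith [hazard_nonneg lam ζ v])

theorem abs_survival_le_one (lam : State d → ℝ≥0) (ζ : CadlagPath d) (v : ℝ≥0) :
    |survival lam ζ v| ≤ 1 := by
  rw [abs_of_nonneg (survival_nonneg lam ζ v)]
  exact survival_le_one lam ζ v

theorem setIntegral_rate_mul_survival {lam : State d → ℝ≥0} (hlam : Measurable lam) {C : ℝ≥0}
    (hC : ∀ z, lam z ≤ C) (ζ : CadlagPath d) (r : ℝ≥0) :
    ∫ v in Set.Iic r, (lam (ζ.1 v) : ℝ) * survival lam ζ v ∂leb = 1 - survival lam ζ r := by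
  have hm : Measurable (fun v => (lam (ζ.1 v) : ℝ)) :=
    (hlam.comp (measurable_path ζ)).coe_nnreal_real
  have hs : Measurable (survival lam ζ) :=
    (measurable_survival hlam).comp (measurable_prodMk_left (x := ζ))
  have hz : ∀ x : ℝ, 0 ≤ x → hazard lam ζ x.toNNReal
      = ∫ y in (0 : ℝ)..x, (lam (ζ.1 y.toNNReal) : ℝ) := fun x hx => by
    rw [hazard, setIntegral_Iic_leb _ hm, Real.coe_toNNReal _ hx]
  rw [setIntegral_Iic_leb r (hm.fun_mul hs)]
  have h1 := integral_mul_exp_neg_integral (f := fun x => (lam (ζ.1 x.toNNReal) : ℝ))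
    (hm.comp measurable_real_toNNReal) (C := C) (fun _ => NNReal.coe_nonneg _)
    (fun x => NNReal.coe_le_coe.2 (hC _)) r.coe_nonneg
  have h2 := hz r r.coe_nonneg
  rw [Real.toNNReal_coe] at h2
  rw [survival, h2, ← h1]
  refine intervalIntegral.integral_congr fun x hx => ?_
  rw [Set.uIcc_of_le r.coe_nonneg] at hx
  simp only [survival, hz x hx.1]

theorem integrableOn_Iic_leb_of_bdd {f : ℝ≥0 → ℝ} (hf : Measurable f) (r : ℝ≥0) {K : ℝ}
    (hK : ∀ v ≤ r, |f v| ≤ K) : IntegrableOn f (Set.Iic r) leb :=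
  Integrable.of_bound hf.aestronglyMeasurable K
    (ae_restrict_of_forall_mem measurableSet_Iic fun v hv => hK v hv)

/-- The density of the jump time has total mass one along a path of infinite total rate. -/
theorem lintegral_jumpDensity {lam : State d → ℝ≥0} (hlam : Measurable lam) {C : ℝ≥0}
    (hC : ∀ z, lam z ≤ C) {ζ : CadlagPath d} (hζ : ∫⁻ v, (lam (ζ.1 v) : ℝ≥0∞) ∂leb = ∞) :
    ∫⁻ v, jumpDensity lam ζ v ∂leb = 1 := by
  have hm : Measurable (fun v => (lam (ζ.1 v) : ℝ)) :=
    (hlam.comp (measurable_path ζ)).coe_nnreal_real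
  have hs : Measurable (survival lam ζ) :=
    (measurable_survival hlam).comp (measurable_prodMk_left (x := ζ))
  have hun : ⋃ n : ℕ, Set.Iic (n : ℝ≥0) = Set.univ := by
    ext x; simpa using exists_nat_ge x
  have hmono : Monotone fun n : ℕ => Set.Iic (n : ℝ≥0) := fun a b hab =>
    Set.Iic_subset_Iic.2 (Nat.cast_le.2 hab)
  -- Continuity from below of the measure with density `f`. It is used twice: for the rate, to see
  -- that the hazard diverges, and for the jump density.
  have hlim : ∀ f : ℝ≥0 → ℝ≥0∞, Measurable f → Tendsto (fun n : ℕ => ∫⁻ v in Set.Iic (n : ℝ≥0), f v ∂leb) atTop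
      (𝓝 (∫⁻ v, f v ∂leb)) := fun f _ => by
    have h : Tendsto (fun n : ℕ => (leb.withDensity f) (Set.Iic (n : ℝ≥0))) atTop
        (𝓝 ((leb.withDensity f) (⋃ n : ℕ, Set.Iic (n : ℝ≥0)))) :=
      tendsto_measure_iUnion_atTop hmono
    rw [hun] at h
    simpa [withDensity_apply _ measurableSet_Iic] using h
  have hhaz : ∀ n : ℕ, ∫⁻ v in Set.Iic (n : ℝ≥0), (lam (ζ.1 v) : ℝ≥0∞) ∂leb
      = ENNReal.ofReal (hazard lam ζ n) := fun n => by
    rw [hazard, ofReal_integral_eq_lintegral_ofReal]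
    · simp
    · exact integrableOn_Iic_leb_of_bdd hm _ (K := C) fun v _ => by simpa using hC _
    · exact ae_of_all _ fun _ => NNReal.coe_nonneg _
  have h1 := hlim _ (hlam.comp (measurable_path ζ)).coe_nnreal_ennreal
  simp only [Function.comp_apply, hhaz, hζ] at h1
  have h2 : Tendsto (fun n : ℕ => hazard lam ζ n) atTop atTop := by
    exact ENNReal.tendsto_ofReal_nhds_top.1 h1
  have h3 : Tendsto (fun n : ℕ => 1 - survival lam ζ n) atTop (𝓝 1) := by
    simpa [survival, Function.comp_def] using
      (Real.tendsto_exp_neg_atTop_nhds_zero.comp h2).const_sub 1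
  have h4 := hlim (jumpDensity lam ζ) ((measurable_jumpDensity hlam).of_uncurry_left)
  have h5 : ∀ n : ℕ, ∫⁻ v in Set.Iic (n : ℝ≥0), jumpDensity lam ζ v ∂leb
      = ENNReal.ofReal (1 - survival lam ζ n) := fun n => by
    rw [← setIntegral_rate_mul_survival hlam hC, ofReal_integral_eq_lintegral_ofReal]
    · rfl
    · refine integrableOn_Iic_leb_of_bdd (hm.fun_mul hs) _ (K := C * 1) fun v _ => ?_
      rw [abs_mul]
      gcongr
      · simpa using hC _
      · exact abs_survival_le_one _ _ _
    · exact ae_of_all _ fun _ => mul_nonneg (NNReal.coe_nonneg _) (survival_nonneg _ _ _)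
  simp only [h5] at h4
  refine tendsto_nhds_unique h4 ?_
  simpa [Function.comp_def] using (ENNReal.continuous_ofReal.tendsto 1).comp h3

end Survival

/-! ### Dynkin's formula for the intrinsic process killed at rate `λ`. -/

section KilledProcess

variable {d : ℕ}

instance nullSingletonClass_leb : NullSingletonClass leb where
  measure_singleton u := by
    rw [leb_apply (measurableSet_singleton u)]
    refine measure_mono_null (t := {(u : ℝ)}) ?_ Real.volume_singleton
    rintro x ⟨h1, h2⟩
    simp only [Set.mem_preimage, Set.mem_singleton_iff] at h1 ⊢
    rw [← h1, Real.coe_toNNReal _ h2]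

/-- The path `ω` stopped at time `v`. -/
def stopPath (v : ℝ≥0) (ω : CadlagPath d) : CadlagPath d :=
  ⟨fun u => ω.1 (min u v), fun t => by
    constructor
    · refine ContinuousWithinAt.comp (t := Set.Ici (min t v)) (ω.2 (min t v)).1
        (Continuous.continuousWithinAt (by fun_prop)) fun u hu => ?_
      exact min_le_min_right v hu
    · rcases le_or_gt t v with h | h
      · obtain ⟨l, hl⟩ := (ω.2 t).2
        refine ⟨l, hl.congr' ?_⟩
        filter_upwards [self_mem_nhdsWithin] with u hu
        rw [min_eq_left (hu.le.trans h)]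
      · refine ⟨ω.1 v, tendsto_const_nhds.congr' ?_⟩
        filter_upwards [nhdsWithin_le_nhds (Ioi_mem_nhds h)] with u hu
        rw [min_eq_right (le_of_lt hu)]⟩

/-- Every coordinate of the stopped path is a coordinate of the original at a time at most `v`.
Hence any measurable functional that factors through stopping at `v` is measurable with respect to
the past at `v`. -/
theorem measurable_stopPath (v : ℝ≥0) :
    Measurable[pathFiltration d v] (stopPath (d := d) v) := by
  rw [measurable_iff_comap_le]
  change MeasurableSpace.comap _ (MeasurableSpace.comap Subtype.val _) ≤ _
  rw [MeasurableSpace.comap_comp, ← measurable_iff_comap_le]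
  refine (@measurable_pi_iff _ _ _ (pathFiltration d v) _ _).2 fun u => ?_
  have h : Measurable[pathFiltration d (min u v)] (fun ω : CadlagPath d => ω.1 (min u v)) := by
    refine Measurable.mono (comap_measurable _) ?_ le_rfl
    exact le_iSup₂_of_le (f := fun (j : ℝ≥0) (_ : j ≤ min u v) =>
      MeasurableSpace.comap (fun ω : CadlagPath d => ω.1 j) inferInstance) (min u v) le_rfl le_rfl
  exact h.mono ((pathFiltration d).mono (min_le_right u v)) le_rfl

theorem hazard_stopPath (lam : State d → ℝ≥0) (v : ℝ≥0) (ζ : CadlagPath d) :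
    hazard lam (stopPath v ζ) v = hazard lam ζ v := by
  refine setIntegral_congr_fun measurableSet_Iic fun w hw => ?_
  simp only [stopPath, min_eq_left (Set.mem_Iic.1 hw)]

/-- The density `λ(ζ(v)) e^{-∫₀ᵛ λ(ζ(w)) dw}` of the jump time, as a real number. -/
noncomputable def killRate (lam : State d → ℝ≥0) (ζ : CadlagPath d) (v : ℝ≥0) : ℝ :=
  (lam (ζ.1 v) : ℝ) * survival lam ζ v

theorem measurable_killRate {lam : State d → ℝ≥0} (hlam : Measurable lam) :
    Measurable (fun p : CadlagPath d × ℝ≥0 => killRate lam p.1 p.2) :=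
  (hlam.comp measurable_eval).coe_nnreal_real.mul (measurable_survival hlam)

theorem measurable_killRate_filtration {lam : State d → ℝ≥0} (hlam : Measurable lam) (v : ℝ≥0) :
    Measurable[pathFiltration d v] (fun ζ => killRate lam ζ v) := by
  have h : (fun ζ => killRate lam ζ v) = (fun ζ => killRate lam ζ v) ∘ stopPath (d := d) v := by
    ext ζ
    simp only [Function.comp_apply, killRate, survival, hazard_stopPath]
    simp [stopPath]
  rw [h]
  exact ((measurable_killRate hlam).comp (measurable_prodMk_right (y := v))).comp
    (measurable_stopPath v)

theorem killRate_nonneg (lam : State d → ℝ≥0) (ζ : CadlagPath d) (v : ℝ≥0) :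
    0 ≤ killRate lam ζ v := mul_nonneg (NNReal.coe_nonneg _) (survival_nonneg _ _ _)

theorem abs_killRate_le {lam : State d → ℝ≥0} {C : ℝ≥0} (hC : ∀ z, lam z ≤ C)
    (ζ : CadlagPath d) (v : ℝ≥0) : |killRate lam ζ v| ≤ C := by
  rw [abs_of_nonneg (killRate_nonneg _ _ _)]
  calc killRate lam ζ v ≤ C * 1 :=
        mul_le_mul (NNReal.coe_le_coe.2 (hC _)) (survival_le_one _ _ _) (survival_nonneg _ _ _)
          C.coe_nonneg
    _ = C := mul_one _

theorem setIntegral_killRate {lam : State d → ℝ≥0} (hlam : Measurable lam) {C : ℝ≥0}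
    (hC : ∀ z, lam z ≤ C) (ζ : CadlagPath d) (r : ℝ≥0) :
    ∫ v in Set.Iic r, killRate lam ζ v ∂leb = 1 - survival lam ζ r :=
  setIntegral_rate_mul_survival hlam hC ζ r

theorem abs_setIntegral_Iic_leb_le {f : ℝ≥0 → ℝ} {r : ℝ≥0} {K : ℝ} (hK : ∀ v ≤ r, |f v| ≤ K) :
    |∫ v in Set.Iic r, f v ∂leb| ≤ K * r := by
  have h := norm_setIntegral_le_of_norm_le_const (μ := leb) (s := Set.Iic r) (f := f) (C := K)
    (by simp [leb_Iic]) (fun v hv => hK v hv)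
  simpa [measureReal_def, leb_Iic] using h

/-- Integration by parts of `∫₀ᵛ b` against the law of the jump time. -/
theorem setIntegral_killRate_mul_primitive {lam : State d → ℝ≥0} (hlam : Measurable lam) {C : ℝ≥0}
    (hC : ∀ z, lam z ≤ C) (ζ : CadlagPath d) (r : ℝ≥0) {b : ℝ≥0 → ℝ} (hb : Measurable b) {K : ℝ}
    (hK : ∀ v ≤ r, |b v| ≤ K) :
    ∫ v in Set.Iic r, killRate lam ζ v * (∫ u in Set.Iic v, b u ∂leb) ∂leb
      = (∫ u in Set.Iic r, survival lam ζ u * b u ∂leb)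
        - survival lam ζ r * ∫ u in Set.Iic r, b u ∂leb := by
  have hD : Measurable (killRate lam ζ) :=
    (measurable_killRate hlam).comp (measurable_prodMk_left (x := ζ))
  have hS : Measurable (survival lam ζ) :=
    (measurable_survival hlam).comp (measurable_prodMk_left (x := ζ))
  have hK0 : 0 ≤ K := (abs_nonneg _).trans (hK 0 zero_le)
  have hF : Measurable (fun p : ℝ≥0 × ℝ≥0 =>
      killRate lam ζ p.1 * (Set.Iic p.1).indicator b p.2) := by
    refine (hD.comp measurable_fst).mul ?_
    exact Measurable.indicator (s := {p : ℝ≥0 × ℝ≥0 | p.2 ≤ p.1}) (hb.comp measurable_snd)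
      (measurableSet_le measurable_snd measurable_fst)
  have h1 : ∀ v ∈ Set.Iic r, killRate lam ζ v * (∫ u in Set.Iic v, b u ∂leb)
      = ∫ u in Set.Iic r, killRate lam ζ v * (Set.Iic v).indicator b u ∂leb := fun v hv => by
    rw [integral_const_mul, setIntegral_indicator measurableSet_Iic, Set.inter_comm,
      Set.inter_eq_self_of_subset_left (Set.Iic_subset_Iic.2 hv)]
  -- After exchanging the integrals over `u ≤ v ≤ r`, the inner one is the mass of the jump time in
  -- `[u, r]`, that is `S u - S r`. The endpoint `u` is immaterial because `leb` has no atoms.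
  have h2 : ∀ u ∈ Set.Iic r, ∫ v in Set.Iic r, killRate lam ζ v * (Set.Iic v).indicator b u ∂leb
      = survival lam ζ u * b u - survival lam ζ r * b u := fun u hu => by
    have e1 : ∀ v, killRate lam ζ v * (Set.Iic v).indicator b u
        = (killRate lam ζ v - (Set.Iio u).indicator (killRate lam ζ) v) * b u := fun v => by
      by_cases h : u ≤ v
      · simp [h]
      · simp [h, lt_of_not_ge h]
    simp_rw [e1]
    rw [integral_mul_const, integral_sub, setIntegral_indicator measurableSet_Iio,
      Set.inter_eq_self_of_subset_right ((Set.Iio_subset_Iic_self).trans (Set.Iic_subset_Iic.2 hu)),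
      ← integral_Iic_eq_integral_Iio, setIntegral_killRate hlam hC, setIntegral_killRate hlam hC]
    · ring
    · exact integrableOn_Iic_leb_of_bdd hD _ fun v _ => abs_killRate_le hC ζ v
    · exact (integrableOn_Iic_leb_of_bdd hD _ fun v _ => abs_killRate_le hC ζ v).indicator
        measurableSet_Iio
  rw [setIntegral_congr_fun measurableSet_Iic h1, integral_integral_swap,
    setIntegral_congr_fun measurableSet_Iic h2, integral_sub, integral_const_mul]
  · refine integrableOn_Iic_leb_of_bdd (hS.fun_mul hb) _ (K := 1 * K) fun v hv => ?_
    rw [abs_mul]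
    exact mul_le_mul (abs_survival_le_one _ _ _) (hK v hv) (abs_nonneg _) zero_le_one
  · exact (integrableOn_Iic_leb_of_bdd hb _ hK).const_mul _
  · refine Integrable.of_bound hF.aestronglyMeasurable (C * K) ?_
    rw [Measure.prod_restrict]
    refine ae_restrict_of_forall_mem (measurableSet_Iic.prod measurableSet_Iic) fun p hp => ?_
    simp only [Function.uncurry, norm_mul]
    refine mul_le_mul (abs_killRate_le hC ζ _) ?_ (norm_nonneg _) C.coe_nonneg
    exact (norm_indicator_le_norm_self _ _).trans (hK _ hp.2)

theorem measurable_compensated {h a : ℝ≥0 → State d → ℝ} (hh : Measurable (Function.uncurry h))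
    (ha : Measurable (Function.uncurry a)) :
    Measurable (fun p : CadlagPath d × ℝ≥0 => compensated h a p.2 p.1) := by
  have h1 : Measurable (fun p : CadlagPath d × ℝ≥0 => h p.2 (p.1.1 p.2)) :=
    hh.comp (measurable_snd.prodMk measurable_eval)
  have h2 : Measurable (fun p : CadlagPath d × ℝ≥0 => h 0 (p.1.1 0)) :=
    hh.comp (measurable_const.prodMk ((measurable_coord 0).comp measurable_fst))
  have h3 : StronglyMeasurable (fun q : (CadlagPath d × ℝ≥0) × ℝ≥0 =>
      (Set.indicator {q : (CadlagPath d × ℝ≥0) × ℝ≥0 | q.2 ≤ q.1.2}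
        (fun q => a q.2 (q.1.1.1 q.2)) q)) := by
    refine (Measurable.indicator ?_ ?_).stronglyMeasurable
    · exact ha.comp (measurable_snd.prodMk (measurable_eval.comp
        ((measurable_fst.comp measurable_fst).prodMk measurable_snd)))
    · exact measurableSet_le measurable_snd (measurable_snd.comp measurable_fst)
  have h4 := (h3.integral_prod_right' (ν := leb)).measurable
  have h5 : Measurable (fun p : CadlagPath d × ℝ≥0 => ∫ v in Set.Iic p.2, a v (p.1.1 v) ∂leb) := by
    refine (congrArg Measurable (funext fun p => ?_)).mp h4
    rw [← integral_indicator measurableSet_Iic]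
    rfl
  exact (h1.sub h2).sub h5

/-- A bounded function of the past is uncorrelated with future increments of a martingale. -/
theorem integral_mul_martingale_eq {Ω : Type*} {m0 : MeasurableSpace Ω} {ρ : Measure Ω}
    [IsFiniteMeasure ρ] {ℱ : Filtration ℝ≥0 m0} {N : ℝ≥0 → Ω → ℝ} (hN : Martingale N ℱ ρ)
    {v r : ℝ≥0} (hvr : v ≤ r) {φ : Ω → ℝ} (hφ : Measurable[ℱ v] φ) {K : ℝ}
    (hK : ∀ ω, |φ ω| ≤ K) : ∫ ω, φ ω * N r ω ∂ρ = ∫ ω, φ ω * N v ω ∂ρ := by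
  have h1 := condExp_stronglyMeasurable_mul_of_bound (ℱ.le v) (μ := ρ) (f := φ)
    (hφ.stronglyMeasurable) (hN.integrable r) K (ae_of_all _ hK)
  have h2 : ρ[φ * N r | ℱ v] =ᵐ[ρ] φ * N v := by
    filter_upwards [h1, hN.condExp_ae_eq hvr] with ω e1 e2
    rw [e1, Pi.mul_apply, e2, Pi.mul_apply]
  have h3 := integral_condExp (ℱ.le v) (μ := ρ) (f := φ * N r)
  rw [integral_congr_ae h2] at h3
  exact h3.symm

/-- Dynkin's formula for the intrinsic process killed at the jump rate. -/
theorem integral_survival_mul {lam : State d → ℝ≥0} (hlam : Measurable lam) {C : ℝ≥0}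
    (hC : ∀ z, lam z ≤ C) {ρ : Measure (CadlagPath d)} [IsProbabilityMeasure ρ] {z : State d}
    (hρ : ∀ᵐ ζ ∂ρ, ζ.1 0 = z) {h a : ℝ≥0 → State d → ℝ} (hh : Measurable (Function.uncurry h))
    (ha : Measurable (Function.uncurry a)) {r : ℝ≥0} {K : ℝ} (hhK : ∀ s ≤ r, ∀ z, |h s z| ≤ K)
    (haK : ∀ s ≤ r, ∀ z, |a s z| ≤ K) (hmart : Martingale (compensated h a) (pathFiltration d) ρ) :
    ∫ ζ, survival lam ζ r * h r (ζ.1 r) ∂ρ = h 0 z + ∫ ζ, (∫ v in Set.Iic r,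
      survival lam ζ v * (a v (ζ.1 v) - lam (ζ.1 v) * h v (ζ.1 v)) ∂leb) ∂ρ := by
  have hK0 : 0 ≤ K := (abs_nonneg _).trans (hhK 0 zero_le z)
  have hNm := measurable_compensated (d := d) hh ha
  have hNb : ∀ v ≤ r, ∀ ζ : CadlagPath d, |compensated h a v ζ| ≤ K + K + K * r := fun v hv ζ => by
    have e1 := hhK v hv (ζ.1 v)
    have e2 := hhK 0 zero_le (ζ.1 0)
    have e3 : |∫ u in Set.Iic v, a u (ζ.1 u) ∂leb| ≤ K * v :=
      abs_setIntegral_Iic_leb_le fun u hu => haK u (hu.trans hv) _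
    have e4 : K * v ≤ K * r := mul_le_mul_of_nonneg_left (NNReal.coe_le_coe.2 hv) hK0
    rw [compensated]
    refine (abs_sub _ _).trans (add_le_add ((abs_sub _ _).trans (add_le_add e1 e2)) (e3.trans e4))
  have hDm := measurable_killRate (d := d) hlam
  have hSm := measurable_survival (d := d) hlam
  -- the martingale part vanishes
  have hfub : ∀ N : CadlagPath d → ℝ≥0 → ℝ,
      Measurable (fun p : CadlagPath d × ℝ≥0 => N p.1 p.2) →
      (∀ v ≤ r, ∀ ζ, |N ζ v| ≤ K + K + K * r) →
      Integrable (fun p : CadlagPath d × ℝ≥0 => killRate lam p.1 p.2 * N p.1 p.2)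
        (ρ.prod (leb.restrict (Set.Iic r))) := fun N hN hNK => by
    refine Integrable.of_bound (hDm.mul hN).aestronglyMeasurable (C * (K + K + K * r)) ?_
    have hx : ρ.prod (leb.restrict (Set.Iic r))
        = (ρ.prod leb).restrict (Set.univ ×ˢ Set.Iic r) := by
      rw [← Measure.prod_restrict, Measure.restrict_univ]
    rw [hx]
    refine ae_restrict_of_forall_mem (MeasurableSet.univ.prod measurableSet_Iic) fun p hp => ?_
    rw [norm_mul]
    exact mul_le_mul (abs_killRate_le hC _ _) (hNK _ hp.2 _) (norm_nonneg _) C.coe_nonneg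
  have hI1 := hfub (fun ζ _ => compensated h a r ζ)
    (hNm.comp (measurable_fst.prodMk measurable_const)) fun v _ ζ => hNb r le_rfl ζ
  have hI2 := hfub (fun ζ v => compensated h a v ζ) hNm fun v hv ζ => hNb v hv ζ
  have hkey : ∫ ζ, (∫ v in Set.Iic r, killRate lam ζ v * compensated h a r ζ ∂leb) ∂ρ
      = ∫ ζ, (∫ v in Set.Iic r, killRate lam ζ v * compensated h a v ζ ∂leb) ∂ρ := by
    rw [integral_integral_swap (f := fun ζ v => killRate lam ζ v * compensated h a r ζ) hI1,
      integral_integral_swap (f := fun ζ v => killRate lam ζ v * compensated h a v ζ) hI2]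
    refine setIntegral_congr_fun measurableSet_Iic fun v hv => ?_
    exact integral_mul_martingale_eq hmart hv (measurable_killRate_filtration hlam v)
      (fun ζ => abs_killRate_le hC ζ v)
  -- The weight `1` at time `0` reduces the mean to that of `N 0`, which vanishes.
  have hN0 : ∫ ζ, compensated h a r ζ ∂ρ = 0 := by
    have e := integral_mul_martingale_eq hmart (zero_le (a := r)) (φ := fun _ => 1)
      measurable_const (K := 1) (by simp)
    simp only [one_mul] at e
    rw [e]
    have : ∀ ζ : CadlagPath d, compensated h a 0 ζ = 0 := fun ζ => by
      have : Set.Iic (0 : ℝ≥0) = {0} := by ext x; simp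
      simp [compensated, this]
    simp [this]
  -- the pathwise identity
  have hpath : ∀ ζ : CadlagPath d, survival lam ζ r * h r (ζ.1 r)
      = h 0 (ζ.1 0) + (∫ v in Set.Iic r,
        survival lam ζ v * (a v (ζ.1 v) - lam (ζ.1 v) * h v (ζ.1 v)) ∂leb)
        + (compensated h a r ζ - ∫ v in Set.Iic r, killRate lam ζ v * compensated h a r ζ ∂leb)
        + ∫ v in Set.Iic r, killRate lam ζ v * compensated h a v ζ ∂leb := fun ζ => by
    have hζ := measurable_path ζ
    have mh : Measurable (fun v => h v (ζ.1 v)) := hh.comp (measurable_id.prodMk hζ)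
    have ma : Measurable (fun v => a v (ζ.1 v)) := ha.comp (measurable_id.prodMk hζ)
    have mD : Measurable (killRate lam ζ) := hDm.comp (measurable_prodMk_left (x := ζ))
    have mS : Measurable (survival lam ζ) := hSm.comp (measurable_prodMk_left (x := ζ))
    have mN : Measurable (fun v => compensated h a v ζ) :=
      hNm.comp (measurable_prodMk_left (x := ζ))
    -- The primitive is recovered from the other terms of `compensated`, whose joint measurability
    -- is known.
    have mA : Measurable (fun v => ∫ u in Set.Iic v, a u (ζ.1 u) ∂leb) := by
      have : (fun v => ∫ u in Set.Iic v, a u (ζ.1 u) ∂leb)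
          = fun v => h v (ζ.1 v) - h 0 (ζ.1 0) - compensated h a v ζ := by
        ext v; rw [compensated]; ring
      rw [this]
      exact (mh.sub_const _).sub mN
    have iD : ∀ {f : ℝ≥0 → ℝ} {L : ℝ}, Measurable f → (∀ v ≤ r, |f v| ≤ L) →
        IntegrableOn (fun v => killRate lam ζ v * f v) (Set.Iic r) leb := fun {f L} hf hL => by
      refine integrableOn_Iic_leb_of_bdd (mD.fun_mul hf) _ (K := C * L) fun v hv => ?_
      rw [abs_mul]
      exact mul_le_mul (abs_killRate_le hC _ _) (hL v hv) (abs_nonneg _) C.coe_nonneg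
    have e1 := setIntegral_killRate_mul_primitive hlam hC ζ r ma (fun v hv => haK v hv _)
    have e2 : ∫ v in Set.Iic r, killRate lam ζ v * compensated h a v ζ ∂leb
        = (∫ v in Set.Iic r, killRate lam ζ v * h v (ζ.1 v) ∂leb)
          - (1 - survival lam ζ r) * h 0 (ζ.1 0)
          - ∫ v in Set.Iic r, killRate lam ζ v * (∫ u in Set.Iic v, a u (ζ.1 u) ∂leb) ∂leb := by
      rw [← setIntegral_killRate hlam hC, ← integral_mul_const, ← integral_sub, ← integral_sub]
      · refine integral_congr_ae (ae_of_all _ fun v => ?_)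
        simp only [compensated]; ring
      · exact (iD mh fun v hv => hhK v hv _).sub
          (iD (f := fun _ => h 0 (ζ.1 0)) measurable_const fun v _ => hhK 0 zero_le _)
      · refine iD (L := K * r) mA fun v hv => ?_
        exact (abs_setIntegral_Iic_leb_le fun u hu => haK u (hu.trans hv) _).trans
          (mul_le_mul_of_nonneg_left (NNReal.coe_le_coe.2 hv) hK0)
      · exact iD mh fun v hv => hhK v hv _
      · exact iD (f := fun _ => h 0 (ζ.1 0)) measurable_const fun v _ => hhK 0 zero_le _
    have e3 : ∫ v in Set.Iic r,
          survival lam ζ v * (a v (ζ.1 v) - lam (ζ.1 v) * h v (ζ.1 v)) ∂leb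
        = (∫ v in Set.Iic r, survival lam ζ v * a v (ζ.1 v) ∂leb)
          - ∫ v in Set.Iic r, killRate lam ζ v * h v (ζ.1 v) ∂leb := by
      rw [← integral_sub]
      · refine integral_congr_ae (ae_of_all _ fun v => ?_)
        simp only [killRate]; ring
      · refine integrableOn_Iic_leb_of_bdd (mS.fun_mul ma) _ (K := 1 * K) fun v hv => ?_
        rw [abs_mul]
        exact mul_le_mul (abs_survival_le_one _ _ _) (haK v hv _) (abs_nonneg _) zero_le_one
      · exact iD mh fun v hv => hhK v hv _
    -- As `∫ D = 1 - S r`, the bracket equals `S r * N r`. Its term `-S r * ∫ a` cancels the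
    -- boundary term from the integration by parts.
    rw [e2, e3, e1, integral_mul_const, setIntegral_killRate hlam hC, compensated]
    ring
  have iN : Integrable (fun ζ => compensated h a r ζ) ρ := hmart.integrable r
  have i1 : Integrable (fun ζ =>
      ∫ v in Set.Iic r, killRate lam ζ v * compensated h a r ζ ∂leb) ρ := hI1.integral_prod_left
  have i2 : Integrable (fun ζ =>
      ∫ v in Set.Iic r, killRate lam ζ v * compensated h a v ζ ∂leb) ρ := hI2.integral_prod_left
  have iSh : Integrable (fun ζ : CadlagPath d => survival lam ζ r * h r (ζ.1 r)) ρ := by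
    refine Integrable.of_bound (Measurable.aestronglyMeasurable ?_) (1 * K)
      (ae_of_all _ fun ζ => ?_)
    · exact (hSm.comp (measurable_prodMk_right (y := r))).mul
        (hh.comp (measurable_const.prodMk (measurable_coord r)))
    · rw [norm_mul]
      exact mul_le_mul (abs_survival_le_one _ _ _) (hhK r le_rfl _) (abs_nonneg _) zero_le_one
  have ih0 : Integrable (fun ζ : CadlagPath d => h 0 (ζ.1 0)) ρ :=
    Integrable.of_bound (hh.comp (measurable_const.prodMk
      (measurable_coord 0))).aestronglyMeasurable K (ae_of_all _ fun ζ => hhK 0 zero_le _)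
  have eh0 : ∫ ζ, h 0 (ζ.1 0) ∂ρ = h 0 z := by
    rw [integral_congr_ae (g := fun _ => h 0 z) (by filter_upwards [hρ] with ζ hζ; rw [hζ])]
    simp
  -- Solving the pathwise identity for the middle integral expresses it through terms already known
  -- to be integrable.
  have hmid : ∀ ζ : CadlagPath d, ∫ v in Set.Iic r,
        survival lam ζ v * (a v (ζ.1 v) - lam (ζ.1 v) * h v (ζ.1 v)) ∂leb
      = survival lam ζ r * h r (ζ.1 r) - h 0 (ζ.1 0)
        - (compensated h a r ζ - ∫ v in Set.Iic r, killRate lam ζ v * compensated h a r ζ ∂leb)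
        - ∫ v in Set.Iic r, killRate lam ζ v * compensated h a v ζ ∂leb := fun ζ => by
    rw [hpath ζ]; ring
  simp_rw [hmid]
  have i3 : Integrable (fun ζ : CadlagPath d => survival lam ζ r * h r (ζ.1 r) - h 0 (ζ.1 0)) ρ :=
    iSh.sub ih0
  have i4 : Integrable (fun ζ => compensated h a r ζ -
      ∫ v in Set.Iic r, killRate lam ζ v * compensated h a r ζ ∂leb) ρ := iN.sub i1
  have i5 : Integrable (fun ζ : CadlagPath d => survival lam ζ r * h r (ζ.1 r) - h 0 (ζ.1 0) -
      (compensated h a r ζ - ∫ v in Set.Iic r, killRate lam ζ v * compensated h a r ζ ∂leb)) ρ :=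
    i3.sub i4
  rw [integral_sub i5 i2, integral_sub i3 i4, integral_sub iSh ih0,
    integral_sub iN i1, hkey, hN0, eh0]
  ring

end KilledProcess

/-! ### The jump law and Dynkin's formula up to the first jump. -/

section FirstJump

variable {d : ℕ}

theorem measurable_integral_kernel {Q : Kernel (State d) (State d)} [IsSFiniteKernel Q]
    {h : ℝ≥0 → State d → ℝ} (hh : Measurable (Function.uncurry h)) :
    Measurable (fun p : ℝ≥0 × State d => ∫ x, h p.1 x ∂(Q p.2)) := by
  have h1 : StronglyMeasurable (fun q : (ℝ≥0 × State d) × State d => h q.1.1 q.2) :=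
    (hh.comp ((measurable_fst.comp measurable_fst).prodMk measurable_snd)).stronglyMeasurable
  exact (h1.integral_kernel_prod_right' (κ := Q.comap (Prod.snd : ℝ≥0 × State d → State d)
    measurable_snd)).measurable

theorem abs_integral_kernel_le {Q : Kernel (State d) (State d)} [IsMarkovKernel Q]
    {f : State d → ℝ} {K : ℝ} (hK : ∀ x, |f x| ≤ K) (z : State d) : |∫ x, f x ∂(Q z)| ≤ K := by
  simpa using norm_integral_le_of_norm_le_const (μ := Q z) (f := f) (ae_of_all _ hK)

theorem switchedGenerator_eq {lam : State d → ℝ≥0} {Q : Kernel (State d) (State d)}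
    [IsMarkovKernel Q] {g a : ℝ≥0 → State d → ℝ} (hg : Measurable (Function.uncurry g)) {v : ℝ≥0}
    {K : ℝ} (hK : ∀ x, |g v x| ≤ K) (z : State d) :
    switchedGenerator lam Q g a v z = a v z + lam z * ((∫ x, g v x ∂(Q z)) - g v z) := by
  rw [switchedGenerator, integral_sub _ (integrable_const _)]
  · simp
  · exact Integrable.of_bound hg.of_uncurry_left.aestronglyMeasurable K (ae_of_all _ hK)

theorem measurable_switchedGenerator {lam : State d → ℝ≥0} (hlam : Measurable lam)
    {Q : Kernel (State d) (State d)} [IsMarkovKernel Q] {g a : ℝ≥0 → State d → ℝ}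
    (hg : Measurable (Function.uncurry g)) (hgb : BoundedOnStrips g)
    (ha : Measurable (Function.uncurry a)) :
    Measurable (Function.uncurry (switchedGenerator lam Q g a)) := by
  have h1 : Function.uncurry (switchedGenerator lam Q g a) = fun p : ℝ≥0 × State d =>
      a p.1 p.2 + lam p.2 * ((∫ x, g p.1 x ∂(Q p.2)) - g p.1 p.2) := by
    ext p
    obtain ⟨K, hK⟩ := hgb p.1
    exact switchedGenerator_eq hg (hK p.1 le_rfl) p.2
  rw [h1]
  exact ha.add ((hlam.comp measurable_snd).coe_nnreal_real.mul
    ((measurable_integral_kernel hg).sub hg))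

theorem boundedOnStrips_switchedGenerator {lam : State d → ℝ≥0} {C : ℝ≥0}
    (hC : ∀ z, lam z ≤ C) {Q : Kernel (State d) (State d)} [IsMarkovKernel Q]
    {g a : ℝ≥0 → State d → ℝ} (hg : Measurable (Function.uncurry g)) (hgb : BoundedOnStrips g)
    (hab : BoundedOnStrips a) : BoundedOnStrips (switchedGenerator lam Q g a) := by
  intro t
  obtain ⟨K, hK⟩ := hgb t
  obtain ⟨L, hL⟩ := hab t
  refine ⟨L + C * (K + K), fun s hs z => ?_⟩
  rw [switchedGenerator_eq hg (hK s hs)]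
  refine (abs_add_le _ _).trans (add_le_add (hL s hs z) ?_)
  rw [abs_mul]
  refine mul_le_mul ?_ ((abs_sub _ _).trans (add_le_add
    (abs_integral_kernel_le (hK s hs) z) (hK s hs z))) (abs_nonneg _) C.coe_nonneg
  simpa using hC z

/-- Real-valued counterpart of `lintegral_jumpKernel`, needed for integrands without a sign. -/
theorem integral_jumpKernel {lam : State d → ℝ≥0} (hlam : Measurable lam)
    (Q : Kernel (State d) (State d)) [IsMarkovKernel Q] (ζ : CadlagPath d)
    {φ : State d × ℝ≥0 → ℝ} (hφ : Integrable φ (jumpKernel lam Q ζ)) :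
    ∫ q, φ q ∂(jumpKernel lam Q ζ)
      = ∫ v, killRate lam ζ v * ∫ x, φ (x, v) ∂(Q (ζ.1 v)) ∂leb := by
  have hM := measurable_jumpDensity hlam
  have hs : IsSFiniteKernel
      (Kernel.withDensity (Kernel.const (CadlagPath d) leb) (jumpDensity lam)) :=
    Kernel.IsSFiniteKernel.withDensity _ fun _ _ => ENNReal.ofReal_ne_top
  rw [jumpKernel, Kernel.map_apply _ measurable_swap] at hφ ⊢
  rw [integral_map measurable_swap.aemeasurable hφ.1]
  have h2 : Integrable (fun p : ℝ≥0 × State d => φ p.swap) _ :=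
    (integrable_map_measure hφ.1 measurable_swap.aemeasurable).1 hφ
  rw [integral_compProd h2, Kernel.withDensity_apply _ hM,
    integral_withDensity_eq_integral_toReal_smul hM.of_uncurry_left
      (ae_of_all _ fun _ => ENNReal.ofReal_lt_top)]
  refine integral_congr_ae (ae_of_all _ fun v => ?_)
  have e : (jumpDensity lam ζ v).toReal = killRate lam ζ v :=
    ENNReal.toReal_ofReal (killRate_nonneg lam ζ v)
  simp only [e, smul_eq_mul]
  rfl

theorem isProbabilityMeasure_jumpKernel {lam : State d → ℝ≥0} (hlam : Measurable lam) {C : ℝ≥0}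
    (hC : ∀ z, lam z ≤ C) (Q : Kernel (State d) (State d)) [IsMarkovKernel Q] {ζ : CadlagPath d}
    (hζ : ∫⁻ v, (lam (ζ.1 v) : ℝ≥0∞) ∂leb = ∞) : IsProbabilityMeasure (jumpKernel lam Q ζ) := by
  constructor
  have h := lintegral_jumpKernel hlam Q ζ (φ := fun _ => 1) measurable_const
  simpa [lintegral_jumpDensity hlam hC hζ] using h

variable {lam : State d → ℝ≥0} {Q : Kernel (State d) (State d)} [IsMarkovKernel Q]

theorem integral_indicator_jumpKernel (hlam : Measurable lam) (ζ : CadlagPath d)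
    [IsProbabilityMeasure (jumpKernel lam Q ζ)] (r : ℝ≥0) {h : ℝ≥0 → State d → ℝ}
    (hh : Measurable (Function.uncurry h)) {K : ℝ} (hK : ∀ v ≤ r, ∀ x, |h v x| ≤ K) :
    ∫ q, (Set.Iic r).indicator (fun v => h v q.1) q.2 ∂(jumpKernel lam Q ζ)
      = ∫ v in Set.Iic r, killRate lam ζ v * ∫ x, h v x ∂(Q (ζ.1 v)) ∂leb := by
  have hm : Measurable (fun q : State d × ℝ≥0 => (Set.Iic r).indicator (fun v => h v q.1) q.2) :=
    Measurable.indicator (s := {q : State d × ℝ≥0 | q.2 ≤ r})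
      (hh.comp (measurable_snd.prodMk measurable_fst))
      (measurableSet_le measurable_snd measurable_const)
  rw [integral_jumpKernel hlam, ← integral_indicator measurableSet_Iic]
  · refine integral_congr_ae (ae_of_all _ fun v => ?_)
    by_cases hv : v ∈ Set.Iic r
    · simp only [Set.indicator_of_mem hv]
    · simp only [Set.indicator_of_notMem hv, integral_zero, mul_zero]
  · refine Integrable.of_bound hm.aestronglyMeasurable |K| (ae_of_all _ fun q => ?_)
    by_cases hv : q.2 ∈ Set.Iic r
    · simp only [Set.indicator_of_mem hv]
      exact (hK _ hv _).trans (le_abs_self K)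
    · simp [Set.indicator_of_notMem hv]

/-- The complementary event has probability `∫ D = 1 - S r`; total mass one of the jump law is
essential. -/
theorem integral_survives_jumpKernel (hlam : Measurable lam) {C : ℝ≥0} (hC : ∀ z, lam z ≤ C)
    (ζ : CadlagPath d) [IsProbabilityMeasure (jumpKernel lam Q ζ)] (r : ℝ≥0) :
    ∫ q, (Set.Ioi r).indicator (fun _ => (1 : ℝ)) q.2 ∂(jumpKernel lam Q ζ)
      = survival lam ζ r := by
  have h1 := integral_indicator_jumpKernel (Q := Q) hlam ζ r (h := fun _ _ => 1) measurable_const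
    (K := 1) (by simp)
  simp only [integral_const, probReal_univ, smul_eq_mul, mul_one] at h1
  rw [setIntegral_killRate hlam hC] at h1
  have h2 : ∀ q : State d × ℝ≥0, (Set.Ioi r).indicator (fun _ => (1 : ℝ)) q.2
      = 1 - (Set.Iic r).indicator (fun _ => (1 : ℝ)) q.2 := fun q => by
    by_cases hq : q.2 ≤ r
    · simp [hq]
    · simp [hq, lt_of_not_ge hq]
  simp_rw [h2]
  rw [integral_sub (integrable_const _), h1]
  · simp
  · refine Integrable.of_bound (Measurable.aestronglyMeasurable ?_) 1 (ae_of_all _ fun q => ?_)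
    · exact (measurable_const.indicator measurableSet_Iic).comp measurable_snd
    · exact (norm_indicator_le_norm_self _ _).trans (by simp)

/-- The value of `h` at the jump time or at the horizon `r`, whichever comes first, minus the
integral of `G` until then. -/
noncomputable def jumpIncrement (h G : ℝ≥0 → State d → ℝ) (r : ℝ≥0) (ζ : CadlagPath d)
    (q : State d × ℝ≥0) : ℝ :=
  (Set.Ioi r).indicator (fun _ => (1 : ℝ)) q.2 * h r (ζ.1 r)
    + (Set.Iic r).indicator (fun v => h v q.1) q.2
    - ∫ w in Set.Iic r, (Set.Ioi w).indicator (fun _ => (1 : ℝ)) q.2 * G w (ζ.1 w) ∂leb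

/-- With the path fixed, only the jump is averaged. Fubini turns the integral of `G` up to the jump
into an integral over all of `[0, r]`, weighted by the probability `S w` of no jump by time `w`. -/
theorem integral_jumpIncrement_jumpKernel (hlam : Measurable lam) {C : ℝ≥0} (hC : ∀ z, lam z ≤ C)
    (ζ : CadlagPath d) [IsProbabilityMeasure (jumpKernel lam Q ζ)] (r : ℝ≥0)
    {h G : ℝ≥0 → State d → ℝ} (hh : Measurable (Function.uncurry h))
    (hG : Measurable (Function.uncurry G)) {K L : ℝ} (hK : ∀ v ≤ r, ∀ x, |h v x| ≤ K)
    (hL : ∀ v ≤ r, ∀ x, |G v x| ≤ L) :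
    ∫ q, jumpIncrement h G r ζ q ∂(jumpKernel lam Q ζ)
      = survival lam ζ r * h r (ζ.1 r)
        + (∫ v in Set.Iic r, killRate lam ζ v * ∫ x, h v x ∂(Q (ζ.1 v)) ∂leb)
        - ∫ w in Set.Iic r, survival lam ζ w * G w (ζ.1 w) ∂leb := by
  have hK0 : 0 ≤ K := (abs_nonneg _).trans (hK r le_rfl 0)
  have hG' : Measurable (fun w => G w (ζ.1 w)) :=
    hG.comp (measurable_id.prodMk (measurable_path ζ))
  have i1 : Integrable (fun q : State d × ℝ≥0 => (Set.Ioi r).indicator (fun _ => (1 : ℝ)) q.2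
      * h r (ζ.1 r)) (jumpKernel lam Q ζ) := by
    refine Integrable.mul_const (Integrable.of_bound (Measurable.aestronglyMeasurable ?_) 1
      (ae_of_all _ fun q => ?_)) _
    · exact (measurable_const.indicator measurableSet_Ioi).comp measurable_snd
    · exact (norm_indicator_le_norm_self _ _).trans (by simp)
  have i2 : Integrable (fun q : State d × ℝ≥0 => (Set.Iic r).indicator (fun v => h v q.1) q.2)
      (jumpKernel lam Q ζ) := by
    refine Integrable.of_bound (Measurable.aestronglyMeasurable ?_) K (ae_of_all _ fun q => ?_)
    · exact Measurable.indicator (s := {q : State d × ℝ≥0 | q.2 ≤ r})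
        (hh.comp (measurable_snd.prodMk measurable_fst))
        (measurableSet_le measurable_snd measurable_const)
    · by_cases hv : q.2 ∈ Set.Iic r
      · simp only [Set.indicator_of_mem hv]
        exact hK _ hv _
      · simp [Set.indicator_of_notMem hv, hK0]
  have i3 : Integrable (Function.uncurry fun (q : State d × ℝ≥0) (w : ℝ≥0) =>
      (Set.Ioi w).indicator (fun _ => (1 : ℝ)) q.2 * G w (ζ.1 w))
      ((jumpKernel lam Q ζ).prod (leb.restrict (Set.Iic r))) := by
    refine Integrable.of_bound (Measurable.aestronglyMeasurable ?_) (1 * L) ?_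
    · refine Measurable.mul ?_ (hG'.comp measurable_snd)
      exact Measurable.indicator (s := {p : (State d × ℝ≥0) × ℝ≥0 | p.2 < p.1.2})
        measurable_const (measurableSet_lt measurable_snd (measurable_snd.comp measurable_fst))
    · have hx : (jumpKernel lam Q ζ).prod (leb.restrict (Set.Iic r))
          = ((jumpKernel lam Q ζ).prod leb).restrict (Set.univ ×ˢ Set.Iic r) := by
        rw [← Measure.prod_restrict, Measure.restrict_univ]
      rw [hx]
      refine ae_restrict_of_forall_mem (MeasurableSet.univ.prod measurableSet_Iic) fun p hp => ?_
      simp only [Function.uncurry, norm_mul]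
      refine mul_le_mul ?_ (hL _ hp.2 _) (norm_nonneg _) zero_le_one
      exact (norm_indicator_le_norm_self _ _).trans (by simp)
  have i12 : Integrable (fun q : State d × ℝ≥0 => (Set.Ioi r).indicator (fun _ => (1 : ℝ)) q.2
      * h r (ζ.1 r) + (Set.Iic r).indicator (fun v => h v q.1) q.2) (jumpKernel lam Q ζ) :=
    i1.add i2
  have i3' : Integrable (fun q : State d × ℝ≥0 => ∫ w in Set.Iic r,
      (Set.Ioi w).indicator (fun _ => (1 : ℝ)) q.2 * G w (ζ.1 w) ∂leb) (jumpKernel lam Q ζ) :=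
    i3.integral_prod_left
  simp only [jumpIncrement]
  rw [integral_sub i12 i3', integral_add i1 i2, integral_mul_const,
    integral_survives_jumpKernel hlam hC, integral_indicator_jumpKernel hlam ζ r hh hK,
    integral_integral_swap i3]
  simp_rw [integral_mul_const, integral_survives_jumpKernel hlam hC]

/-- Dynkin's formula for the switching process up to its first jump. -/
theorem integral_jumpIncrement (hlam : Measurable lam) {C : ℝ≥0} (hC : ∀ z, lam z ≤ C)
    {ρ : Measure (CadlagPath d)} [IsProbabilityMeasure ρ] {z : State d}
    (hρ : ∀ᵐ ζ ∂ρ, ζ.1 0 = z) (hinf : ∀ᵐ ζ ∂ρ, ∫⁻ v, (lam (ζ.1 v) : ℝ≥0∞) ∂leb = ∞)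
    {h a : ℝ≥0 → State d → ℝ} (hh : Measurable (Function.uncurry h)) (hhb : BoundedOnStrips h)
    (ha : Measurable (Function.uncurry a)) (hab : BoundedOnStrips a)
    (hmart : Martingale (compensated h a) (pathFiltration d) ρ) (r : ℝ≥0) :
    ∫ ζ, (∫ q, jumpIncrement h (switchedGenerator lam Q h a) r ζ q ∂(jumpKernel lam Q ζ)) ∂ρ
      = h 0 z := by
  obtain ⟨K₁, hK₁⟩ := hhb r
  obtain ⟨K₂, hK₂⟩ := hab r
  obtain ⟨L, hL⟩ := boundedOnStrips_switchedGenerator (Q := Q) hC hh hhb hab r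
  have hK1 : ∀ v ≤ r, ∀ x, |h v x| ≤ max K₁ K₂ := fun v hv x => (hK₁ v hv x).trans (le_max_left _ _)
  have hK2 : ∀ v ≤ r, ∀ x, |a v x| ≤ max K₁ K₂ := fun v hv x => (hK₂ v hv x).trans (le_max_right _ _)
  set K := max K₁ K₂
  have hK0 : 0 ≤ K := (abs_nonneg _).trans (hK1 r le_rfl 0)
  have hSm := measurable_survival (d := d) hlam
  have hDm := measurable_killRate (d := d) hlam
  have key : ∀ᵐ ζ ∂ρ,
      ∫ q, jumpIncrement h (switchedGenerator lam Q h a) r ζ q ∂(jumpKernel lam Q ζ)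
      = survival lam ζ r * h r (ζ.1 r) - ∫ v in Set.Iic r,
        survival lam ζ v * (a v (ζ.1 v) - lam (ζ.1 v) * h v (ζ.1 v)) ∂leb := by
    filter_upwards [hinf] with ζ hζ
    have := isProbabilityMeasure_jumpKernel hlam hC Q hζ
    have mζ := measurable_path ζ
    have mD : Measurable (killRate lam ζ) := hDm.comp (measurable_prodMk_left (x := ζ))
    have mS : Measurable (survival lam ζ) := hSm.comp (measurable_prodMk_left (x := ζ))
    have mG := measurable_switchedGenerator (Q := Q) hlam hh hhb ha
    have mQ : Measurable (fun v => ∫ x, h v x ∂(Q (ζ.1 v))) :=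
      (measurable_integral_kernel hh).comp (measurable_id.prodMk mζ)
    have mGζ : Measurable (fun v => switchedGenerator lam Q h a v (ζ.1 v)) :=
      mG.comp (measurable_id.prodMk mζ)
    rw [integral_jumpIncrement_jumpKernel hlam hC ζ r hh mG hK1 hL, add_sub_assoc, ← integral_sub,
      sub_eq_add_neg, ← integral_neg]
    · congr 1
      -- Here the post-jump average drops out: `D Qh - S (a + λ (Qh - h)) = -S (a - λ h)`. What
      -- remains is exactly the integral in the killed formula.
      refine setIntegral_congr_fun measurableSet_Iic fun v hv => ?_
      simp only [killRate]
      rw [switchedGenerator_eq hh (hK1 v hv)]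
      ring
    · refine integrableOn_Iic_leb_of_bdd (mD.fun_mul mQ) r (K := C * K) fun v hv => ?_
      rw [abs_mul]
      exact mul_le_mul (abs_killRate_le hC _ _) (abs_integral_kernel_le (hK1 v hv) _)
        (abs_nonneg _) C.coe_nonneg
    · refine integrableOn_Iic_leb_of_bdd (mS.fun_mul mGζ) r (K := 1 * L) fun v hv => ?_
      rw [abs_mul]
      exact mul_le_mul (abs_survival_le_one _ _ _) (hL v hv _) (abs_nonneg _) zero_le_one
  rw [integral_congr_ae key, integral_sub,
    integral_survival_mul hlam hC hρ hh ha hK1 hK2 hmart, add_sub_cancel_right]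
  · refine Integrable.of_bound (Measurable.aestronglyMeasurable ?_) (1 * K)
      (ae_of_all _ fun ζ => ?_)
    · exact (hSm.comp (measurable_prodMk_right (y := r))).mul
        (hh.comp (measurable_const.prodMk (measurable_coord r)))
    · rw [norm_mul]
      exact mul_le_mul (abs_survival_le_one _ _ _) (hK1 r le_rfl _) (abs_nonneg _) zero_le_one
  · refine Integrable.of_bound (StronglyMeasurable.aestronglyMeasurable ?_)
      (1 * (K + C * K) * r) (ae_of_all _ fun ζ => ?_)
    · have hm : Measurable (fun p : CadlagPath d × ℝ≥0 => survival lam p.1 p.2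
          * (a p.2 (p.1.1 p.2) - lam (p.1.1 p.2) * h p.2 (p.1.1 p.2))) :=
        hSm.mul ((ha.comp (measurable_snd.prodMk measurable_eval)).sub
          ((hlam.comp measurable_eval).coe_nnreal_real.mul
            (hh.comp (measurable_snd.prodMk measurable_eval))))
      exact hm.stronglyMeasurable.integral_prod_right'
    · refine abs_setIntegral_Iic_leb_le fun v hv => ?_
      rw [abs_mul]
      refine mul_le_mul (abs_survival_le_one _ _ _) ((abs_sub _ _).trans (add_le_add (hK2 v hv _) ?_))
        (abs_nonneg _) zero_le_one
      rw [abs_mul]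
      refine mul_le_mul ?_ (hK1 v hv _) (abs_nonneg _) C.coe_nonneg
      simpa using hC _

end FirstJump

/-! ### Conditional laws of one step, non-explosion, and measurability of the trajectory. -/

section Construction

section CondDistrib

variable {Ω 𝓧 𝓨 : Type*} [MeasurableSpace Ω] [MeasurableSpace 𝓧] [MeasurableSpace 𝓨]
  {Pr : Measure Ω} [IsFiniteMeasure Pr] {X : Ω → 𝓧} {Y : Ω → 𝓨} {κ : Kernel 𝓧 𝓨}
  [IsSFiniteKernel κ]

theorem HasCondDistrib.lintegral_eq (h : HasCondDistrib Y X κ Pr) {f : 𝓧 × 𝓨 → ℝ≥0∞}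
    (hf : Measurable f) :
    ∫⁻ ω, f (X ω, Y ω) ∂Pr = ∫⁻ ω, ∫⁻ y, f (X ω, y) ∂(κ (X ω)) ∂Pr := by
  rw [← lintegral_map' hf.aemeasurable h.aemeasurable, h.map_eq, Measure.lintegral_compProd hf,
    lintegral_map' hf.lintegral_kernel_prod_right'.aemeasurable h.aemeasurable_fst]

theorem HasCondDistrib.integrable_integral (h : HasCondDistrib Y X κ Pr) {f : 𝓧 × 𝓨 → ℝ}
    (hf : Measurable f) (hi : Integrable (fun ω => f (X ω, Y ω)) Pr) :
    Integrable (fun ω => ∫ y, f (X ω, y) ∂(κ (X ω))) Pr := by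
  have h1 := (integrable_map_measure hf.aestronglyMeasurable h.aemeasurable).2 hi
  rw [h.map_eq, Measure.compProd] at h1
  have h2 := h1.integral_compProd
  simp only [Kernel.prodMkLeft_apply, Kernel.const_apply] at h2
  exact h2.comp_aemeasurable h.aemeasurable_fst

theorem HasCondDistrib.integral_eq (h : HasCondDistrib Y X κ Pr) {f : 𝓧 × 𝓨 → ℝ}
    (hf : Measurable f) (hi : Integrable (fun ω => f (X ω, Y ω)) Pr) :
    ∫ ω, f (X ω, Y ω) ∂Pr = ∫ ω, ∫ y, f (X ω, y) ∂(κ (X ω)) ∂Pr := by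
  have h1 := (integrable_map_measure hf.aestronglyMeasurable h.aemeasurable).2 hi
  rw [← integral_map h.aemeasurable hf.aestronglyMeasurable]
  rw [h.map_eq] at h1 ⊢
  rw [Measure.integral_compProd h1, integral_map h.aemeasurable_fst
    hf.stronglyMeasurable.integral_kernel_prod_right'.aestronglyMeasurable]

end CondDistrib

variable {d : ℕ} {Ω : Type*} [MeasurableSpace Ω] {P : Kernel (State d) (CadlagPath d)}
  {lam : State d → ℝ≥0} {Q : Kernel (State d) (State d)} {μ : Measure (State d)}
  {Pr : Measure Ω} {ζ : ℕ → Ω → CadlagPath d} {Y : ℕ → Ω → State d} {T : ℕ → Ω → ℝ≥0}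
  {X : ℝ≥0 → Ω → State d}

/-- The kernel depends on the history only through `Yₙ`, so conditioning can be coarsened. `Tₙ` is
retained because the shifted test functions depend on it. -/
theorem IsSwitchingConstruction.hasCondDistrib_path [IsFiniteMeasure Pr] [IsMarkovKernel P]
    (hS : IsSwitchingConstruction P lam Q μ Pr ζ Y T X) (n : ℕ) :
    HasCondDistrib (m𝓧 := Prod.instMeasurableSpace) (ζ n) (fun ω => (Y n ω, T n ω))
      (P.comap (fun p : State d × ℝ≥0 => p.1) measurable_fst) Pr := by
  have hm : Measurable (fun h : History d n => h.2 (Fin.last n)) :=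
    (measurable_pi_apply (Fin.last n)).comp measurable_snd
  exact HasCondDistrib.comp_right
    (κ := P.comap (fun p : State d × ℝ≥0 => p.1) measurable_fst)
    (f := fun h : History d n => h.2 (Fin.last n)) (hf := hm)
    (hS.law_path n)

theorem IsSwitchingConstruction.hasCondDistrib_jump [IsFiniteMeasure Pr] [IsMarkovKernel Q]
    (hS : IsSwitchingConstruction P lam Q μ Pr ζ Y T X) (n : ℕ) :
    HasCondDistrib (fun ω => (Y (n + 1) ω, T (n + 1) ω - T n ω))
      (fun ω => ((Y n ω, T n ω), ζ n ω))
      (Kernel.prodMkLeft (State d × ℝ≥0) (jumpKernel lam Q)) Pr := by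
  have hm : Measurable (fun h : History d n × CadlagPath d => (h.1.2 (Fin.last n), h.2)) :=
    ((measurable_pi_apply (Fin.last n)).comp (measurable_snd.comp measurable_fst)).prodMk
      measurable_snd
  exact HasCondDistrib.comp_right
    (κ := Kernel.prodMkLeft (State d × ℝ≥0) (jumpKernel lam Q))
    (f := fun h : History d n × CadlagPath d => (h.1.2 (Fin.last n), h.2)) (hf := hm)
    (hS.law_jump n)

theorem IsSwitchingConstruction.integral_step [IsFiniteMeasure Pr] [IsMarkovKernel P]
    [IsMarkovKernel Q] (hS : IsSwitchingConstruction P lam Q μ Pr ζ Y T X) (n : ℕ)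
    {f : ((State d × ℝ≥0) × CadlagPath d) × (State d × ℝ≥0) → ℝ} (hf : Measurable f)
    (hi : Integrable (fun ω => f (((Y n ω, T n ω), ζ n ω), (Y (n + 1) ω, T (n + 1) ω - T n ω))) Pr) :
    ∫ ω, f (((Y n ω, T n ω), ζ n ω), (Y (n + 1) ω, T (n + 1) ω - T n ω)) ∂Pr
      = ∫ ω, ∫ η, ∫ q, f (((Y n ω, T n ω), η), q) ∂(jumpKernel lam Q η) ∂(P (Y n ω)) ∂Pr := by
  have h1 := hS.hasCondDistrib_jump n
  have h2 := HasCondDistrib.integrable_integral h1 hf hi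
  rw [HasCondDistrib.integral_eq h1 hf hi]
  simp only [Kernel.prodMkLeft_apply] at h2 ⊢
  have hm : StronglyMeasurable (fun p : (State d × ℝ≥0) × CadlagPath d =>
      ∫ q, f (p, q) ∂(jumpKernel lam Q p.2)) :=
    hf.stronglyMeasurable.integral_kernel_prod_right'
      (κ := Kernel.prodMkLeft (State d × ℝ≥0) (jumpKernel lam Q))
  exact HasCondDistrib.integral_eq (hS.hasCondDistrib_path n) hm.measurable h2

/-- The waiting-time density is at most `C`, so with `θ = 2C + 1` its Laplace transform at `θ` is at
most `C / θ ≤ 1/2`, whatever the past. The `+ 1` keeps `θ` positive when `C = 0`. -/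
theorem IsSwitchingConstruction.lintegral_exp_neg_time_le [IsFiniteMeasure Pr] [IsMarkovKernel Q]
    (hS : IsSwitchingConstruction P lam Q μ Pr ζ Y T X) (hlam : Measurable lam) {C : ℝ≥0}
    (hC : ∀ z, lam z ≤ C) (n : ℕ) :
    ∫⁻ ω, ENNReal.ofReal (Real.exp (-(2 * C + 1) * T (n + 1) ω)) ∂Pr
      ≤ 2⁻¹ * ∫⁻ ω, ENNReal.ofReal (Real.exp (-(2 * C + 1) * T n ω)) ∂Pr := by
  have hθ : (0 : ℝ) < 2 * C + 1 := by positivity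
  set θ : ℝ := 2 * C + 1 with hθdef
  have he : Measurable (fun v : ℝ≥0 => ENNReal.ofReal (Real.exp (-θ * v))) := by fun_prop
  have he' : Measurable (fun q : State d × ℝ≥0 => ENNReal.ofReal (Real.exp (-θ * q.2))) :=
    he.comp measurable_snd
  have h1 : ∫⁻ ω, ENNReal.ofReal (Real.exp (-θ * T (n + 1) ω)) ∂Pr
      = ∫⁻ ω, ENNReal.ofReal (Real.exp (-θ * T n ω))
        * ENNReal.ofReal (Real.exp (-θ * ((T (n + 1) ω - T n ω : ℝ≥0) : ℝ))) ∂Pr := by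
    refine lintegral_congr_ae ?_
    -- Subtraction in `ℝ≥0` is truncated; monotonicity of the jump times makes it the true
    -- difference.
    filter_upwards [hS.time_le] with ω hω
    rw [← ENNReal.ofReal_mul (Real.exp_pos _).le, ← Real.exp_add, NNReal.coe_sub (hω n)]
    congr 2
    ring
  have h2 : ∀ η : CadlagPath d,
      ∫⁻ q, ENNReal.ofReal (Real.exp (-θ * q.2)) ∂(jumpKernel lam Q η) ≤ 2⁻¹ := fun η => by
    rw [lintegral_jumpKernel hlam Q η he']
    simp only [lintegral_const, measure_univ, mul_one]
    calc ∫⁻ v, jumpDensity lam η v * ENNReal.ofReal (Real.exp (-θ * v)) ∂leb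
        ≤ ∫⁻ v, ENNReal.ofReal C * ENNReal.ofReal (Real.exp (-θ * v)) ∂leb := by
          refine lintegral_mono fun v => mul_le_mul_left (ENNReal.ofReal_le_ofReal ?_) _
          exact (le_abs_self _).trans (abs_killRate_le hC η v)
      _ = ENNReal.ofReal (C * θ⁻¹) := by
          rw [lintegral_const_mul _ he, lintegral_exp_neg_mul_leb hθ,
            ENNReal.ofReal_mul C.coe_nonneg]
      _ ≤ ENNReal.ofReal 2⁻¹ := by
          refine ENNReal.ofReal_le_ofReal ?_
          rw [← div_eq_mul_inv, div_le_iff₀ hθ, hθdef]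
          linarith
      _ = 2⁻¹ := by
          rw [ENNReal.ofReal_inv_of_pos two_pos]
          simp
  have hf : Measurable (fun p : ((State d × ℝ≥0) × CadlagPath d) × (State d × ℝ≥0) =>
      ENNReal.ofReal (Real.exp (-θ * p.1.1.2)) * ENNReal.ofReal (Real.exp (-θ * p.2.2))) :=
    (he.comp (measurable_snd.comp (measurable_fst.comp measurable_fst))).mul
      (he.comp (measurable_snd.comp measurable_snd))
  have h3 := HasCondDistrib.lintegral_eq (hS.hasCondDistrib_jump n) hf
  simp only [Kernel.prodMkLeft_apply] at h3
  rw [h1, h3, ← lintegral_const_mul' _ _ (by simp)]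
  refine lintegral_mono fun ω => ?_
  dsimp only
  rw [lintegral_const_mul _ he', mul_comm]
  exact mul_le_mul_left (h2 _) _

/-- A switching process with bounded jump rate does not explode. -/
theorem IsSwitchingConstruction.tendsto_time [IsProbabilityMeasure Pr] [IsMarkovKernel Q]
    (hS : IsSwitchingConstruction P lam Q μ Pr ζ Y T X) (hlam : Measurable lam) {C : ℝ≥0}
    (hC : ∀ z, lam z ≤ C) : ∀ᵐ ω ∂Pr, ∀ t, ∃ n, t < T n ω := by
  set e : ℕ → Ω → ℝ≥0∞ := fun n ω => ENNReal.ofReal (Real.exp (-(2 * C + 1) * T n ω)) with he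
  have hm : ∀ n, Measurable (e n) := fun n => by
    have := hS.measurable_time n
    fun_prop
  have h1 : ∀ n, ∫⁻ ω, e n ω ∂Pr ≤ 2⁻¹ ^ n := by
    intro n
    induction n with
    | zero =>
      refine (lintegral_mono (g := fun _ => 1) fun ω => ?_).trans (by simp)
      rw [he, ← ENNReal.ofReal_one]
      refine ENNReal.ofReal_le_ofReal (Real.exp_le_one_iff.2 ?_)
      rw [neg_mul]
      exact neg_nonpos.2 (by positivity)
    | succ n ih =>
      refine (hS.lintegral_exp_neg_time_le hlam hC n).trans ?_
      rw [pow_succ']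
      exact mul_le_mul_right ih _
  -- The geometric bound makes the sum of the `e n` almost surely finite, so `e n` tends to `0` and
  -- the jump times exceed every `t`.
  have h2 : ∫⁻ ω, ∑' n, e n ω ∂Pr ≠ ∞ := by
    rw [lintegral_tsum fun n => (hm n).aemeasurable]
    refine ne_top_of_le_ne_top ?_ (ENNReal.tsum_le_tsum h1)
    rw [ENNReal.tsum_geometric]
    simp
  filter_upwards [ae_lt_top' (AEMeasurable.tsum fun n => (hm n).aemeasurable) h2]
    with ω hω t
  have h3 := ENNReal.tendsto_atTop_zero_of_tsum_ne_top hω.ne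
  have h4 : ∀ᶠ n in atTop, e n ω < ENNReal.ofReal (Real.exp (-(2 * C + 1) * t)) :=
    h3.eventually_lt_const (ENNReal.ofReal_pos.2 (Real.exp_pos _))
  obtain ⟨n, hn⟩ := h4.exists
  refine ⟨n, ?_⟩
  rw [he, ENNReal.ofReal_lt_ofReal_iff (Real.exp_pos _), Real.exp_lt_exp, neg_mul, neg_mul,
    neg_lt_neg_iff, mul_lt_mul_iff_right₀ (by positivity)] at hn
  exact_mod_cast hn

/-- The measure `ν` is left free so that one argument covers both a fixed time and the product of
Lebesgue measure with the probability. -/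
theorem IsSwitchingConstruction.aemeasurable_of_ae
    (hS : IsSwitchingConstruction P lam Q μ Pr ζ Y T X) {ν : Measure (ℝ≥0 × Ω)}
    (h0 : ∀ᵐ p ∂ν, T 0 p.2 = 0) (hT : ∀ᵐ p ∂ν, ∀ t, ∃ n, t < T n p.2)
    (hmono : ∀ᵐ p ∂ν, ∀ n, T n p.2 ≤ T (n + 1) p.2)
    (hX : ∀ᵐ p ∂ν, ∀ n t, T n p.2 ≤ t → t < T (n + 1) p.2 → X t p.2 = (ζ n p.2).1 (t - T n p.2)) :
    AEMeasurable (fun p : ℝ≥0 × Ω => X p.1 p.2) ν := by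
  classical
  let A : ℕ → Set (ℝ≥0 × Ω) := fun n => {p | T n p.2 ≤ p.1} ∩ {p | p.1 < T (n + 1) p.2}
  -- `x n` glues the first `n` excursions, with default value `0` elsewhere. It agrees with `X`
  -- before `Tₙ`, so the sequence is eventually constant at almost every point.
  let x : ℕ → ℝ≥0 × Ω → State d := fun n => Nat.rec (fun _ => 0)
    (fun k y => (A k).piecewise (fun p => (ζ k p.2).1 (p.1 - T k p.2)) y) n
  have hTm : ∀ n, Measurable (fun p : ℝ≥0 × Ω => T n p.2) := fun n =>
    (hS.measurable_time n).comp measurable_snd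
  have hx : ∀ n, Measurable (x n) := by
    intro n
    induction n with
    | zero => exact measurable_const
    | succ k ih =>
      refine Measurable.piecewise ((measurableSet_le (hTm k) measurable_fst).inter
        (measurableSet_lt measurable_fst (hTm (k + 1)))) ?_ ih
      exact measurable_eval.comp (((hS.measurable_path k).comp measurable_snd).prodMk
        (measurable_fst.sub (hTm k)))
  refine aemeasurable_of_tendsto_metrizable_ae atTop (fun n => (hx n).aemeasurable) ?_
  filter_upwards [h0, hT, hmono, hX] with p h0 hT hmono hX
  have key : ∀ n, p.1 < T n p.2 → x n p = X p.1 p.2 := by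
    intro n
    induction n with
    | zero => intro h; rw [h0] at h; exact absurd h not_lt_zero
    | succ k ih =>
      intro h
      change (A k).piecewise _ (x k) p = _
      by_cases hk : T k p.2 ≤ p.1
      · rw [Set.piecewise_eq_of_mem _ _ _ (show p ∈ A k from ⟨hk, h⟩), hX k p.1 hk h]
      · rw [Set.piecewise_eq_of_notMem _ _ _ (show p ∉ A k from fun h' => hk h'.1)]
        exact ih (lt_of_not_ge hk)
  obtain ⟨N, hN⟩ := hT p.1
  refine tendsto_const_nhds.congr' ?_
  filter_upwards [eventually_ge_atTop N] with n hn
  exact (key n (hN.trans_le (monotone_nat_of_le_succ (f := fun n => T n p.2) hmono hn))).symm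

end Construction

/-! ### Summing the increments over successive jumps. -/

section Telescoping

variable {d : ℕ}

/-- `jumpIncrement` for the functions shifted to the current jump time `s`, with horizon `t`; it
vanishes if `t < s`. The argument is `((y, s), ζ), (x, v)`. -/
noncomputable def stepValue (g G : ℝ≥0 → State d → ℝ) (t : ℝ≥0)
    (p : ((State d × ℝ≥0) × CadlagPath d) × (State d × ℝ≥0)) : ℝ :=
  (Set.Iic t).indicator
    (fun s => jumpIncrement (timeShift s g) (timeShift s G) (t - s) p.1.2 p.2) p.1.1.2

theorem measurable_stepValue {g G : ℝ≥0 → State d → ℝ} (hg : Measurable (Function.uncurry g))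
    (hG : Measurable (Function.uncurry G)) (t : ℝ≥0) : Measurable (stepValue g G t) := by
  have ms : Measurable (fun p : ((State d × ℝ≥0) × CadlagPath d) × (State d × ℝ≥0) => p.1.1.2) :=
    measurable_snd.comp (measurable_fst.comp measurable_fst)
  have mζ : Measurable (fun p : ((State d × ℝ≥0) × CadlagPath d) × (State d × ℝ≥0) => p.1.2) :=
    measurable_snd.comp measurable_fst
  have mx : Measurable (fun p : ((State d × ℝ≥0) × CadlagPath d) × (State d × ℝ≥0) => p.2.1) :=
    measurable_fst.comp measurable_snd
  have mv : Measurable (fun p : ((State d × ℝ≥0) × CadlagPath d) × (State d × ℝ≥0) => p.2.2) :=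
    measurable_snd.comp measurable_snd
  have mr := ms.const_sub t
  have h1 : Measurable (fun p : ((State d × ℝ≥0) × CadlagPath d) × (State d × ℝ≥0) =>
      (Set.Ioi (t - p.1.1.2)).indicator (fun _ => (1 : ℝ)) p.2.2
        * g (p.1.1.2 + (t - p.1.1.2)) (p.1.2.1 (t - p.1.1.2))) := by
    refine Measurable.mul ?_ (hg.comp ((ms.add mr).prodMk (measurable_eval.comp (mζ.prodMk mr))))
    exact Measurable.indicator (s := {p : ((State d × ℝ≥0) × CadlagPath d) × (State d × ℝ≥0) |
      t - p.1.1.2 < p.2.2}) measurable_const (measurableSet_lt mr mv)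
  have h2 : Measurable (fun p : ((State d × ℝ≥0) × CadlagPath d) × (State d × ℝ≥0) =>
      (Set.Iic (t - p.1.1.2)).indicator (fun v => g (p.1.1.2 + v) p.2.1) p.2.2) :=
    Measurable.indicator (s := {p : ((State d × ℝ≥0) × CadlagPath d) × (State d × ℝ≥0) |
      p.2.2 ≤ t - p.1.1.2}) (hg.comp ((ms.add mv).prodMk mx)) (measurableSet_le mv mr)
  have h3 : Measurable (fun p : ((State d × ℝ≥0) × CadlagPath d) × (State d × ℝ≥0) =>
      ∫ w in Set.Iic (t - p.1.1.2), (Set.Ioi w).indicator (fun _ => (1 : ℝ)) p.2.2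
        * G (p.1.1.2 + w) (p.1.2.1 w) ∂leb) := by
    have h4 : Measurable (fun q : (((State d × ℝ≥0) × CadlagPath d) × (State d × ℝ≥0)) × ℝ≥0 =>
        (Set.Iic (t - q.1.1.1.2)).indicator (fun w => (Set.Ioi w).indicator (fun _ => (1 : ℝ))
          q.1.2.2 * G (q.1.1.1.2 + w) (q.1.1.2.1 w)) q.2) := by
      refine Measurable.indicator
        (s := {q : (((State d × ℝ≥0) × CadlagPath d) × (State d × ℝ≥0)) × ℝ≥0 |
          q.2 ≤ t - q.1.1.1.2}) (Measurable.mul ?_ ?_)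
        (measurableSet_le measurable_snd (mr.comp measurable_fst))
      · exact Measurable.indicator
          (s := {q : (((State d × ℝ≥0) × CadlagPath d) × (State d × ℝ≥0)) × ℝ≥0 |
            q.2 < q.1.2.2}) measurable_const
          (measurableSet_lt measurable_snd (mv.comp measurable_fst))
      · exact hG.comp (((ms.comp measurable_fst).add measurable_snd).prodMk
          (measurable_eval.comp ((mζ.comp measurable_fst).prodMk measurable_snd)))
    have h5 := (h4.stronglyMeasurable.integral_prod_right' (ν := leb)).measurable
    refine (congrArg Measurable (funext fun p => ?_)).mp h5
    rw [← integral_indicator measurableSet_Iic]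
  exact Measurable.indicator (s := {p : ((State d × ℝ≥0) × CadlagPath d) × (State d × ℝ≥0) |
    p.1.1.2 ≤ t}) ((h1.add h2).sub h3) (measurableSet_le ms measurable_const)

theorem abs_stepValue_le {g G : ℝ≥0 → State d → ℝ} {t : ℝ≥0} {K L : ℝ}
    (hK : ∀ s ≤ t, ∀ z, |g s z| ≤ K) (hL : ∀ s ≤ t, ∀ z, |G s z| ≤ L)
    (p : ((State d × ℝ≥0) × CadlagPath d) × (State d × ℝ≥0)) :
    |stepValue g G t p| ≤ K + K + L * t := by
  have hK0 : 0 ≤ K := (abs_nonneg _).trans (hK t le_rfl 0)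
  have hL0 : 0 ≤ L := (abs_nonneg _).trans (hL t le_rfl 0)
  by_cases hs : p.1.1.2 ∈ Set.Iic t
  · rw [stepValue, Set.indicator_of_mem hs, jumpIncrement]
    have hadd : ∀ {w}, w ≤ t - p.1.1.2 → p.1.1.2 + w ≤ t := fun {w} hw =>
      (le_tsub_iff_left (Set.mem_Iic.1 hs)).1 hw
    have h1 : ∀ w : ℝ≥0, |(Set.Ioi w).indicator (fun _ => (1 : ℝ)) p.2.2| ≤ 1 := fun w =>
      (norm_indicator_le_norm_self (fun _ => (1 : ℝ)) _).trans (by simp)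
    refine (abs_sub _ _).trans (add_le_add ((abs_add_le _ _).trans (add_le_add ?_ ?_)) ?_)
    · rw [abs_mul]
      exact (mul_le_mul (h1 _) (hK _ (hadd le_rfl) _) (abs_nonneg _) zero_le_one).trans_eq
        (one_mul _)
    · by_cases hv : p.2.2 ∈ Set.Iic (t - p.1.1.2)
      · rw [Set.indicator_of_mem hv]
        exact hK _ (hadd hv) _
      · rw [Set.indicator_of_notMem hv, abs_zero]
        exact hK0
    · refine (abs_setIntegral_Iic_leb_le (K := L) fun w hw => ?_).trans ?_
      · rw [abs_mul]
        exact (mul_le_mul (h1 _) (hL _ (hadd hw) _) (abs_nonneg _) zero_le_one).trans_eq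
          (one_mul _)
      · exact mul_le_mul_of_nonneg_left (NNReal.coe_le_coe.2 tsub_le_self) hL0
  · rw [stepValue, Set.indicator_of_notMem hs, abs_zero]
    positivity

/-- Along a path which follows `η n` on `[τₙ, τₙ₊₁)`, the increments telescope. -/
theorem sum_stepValue_eq {x : ℝ≥0 → State d} {η : ℕ → CadlagPath d} {y : ℕ → State d}
    {τ : ℕ → ℝ≥0} (h0 : τ 0 = 0) (hle : ∀ n, τ n ≤ τ (n + 1))
    (hx : ∀ n s, τ n ≤ s → s < τ (n + 1) → x s = (η n).1 (s - τ n))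
    {g G : ℝ≥0 → State d → ℝ} (hG : Measurable (Function.uncurry G)) {t : ℝ≥0} {L : ℝ}
    (hL : ∀ s ≤ t, ∀ z, |G s z| ≤ L) (N : ℕ) :
    Measurable ((Set.Iio (τ N)).indicator fun s => G s (x s)) ∧
    g 0 (y 0) + ∑ n ∈ Finset.range N,
        (stepValue g G t (((y n, τ n), η n), (y (n + 1), τ (n + 1) - τ n))
          - (Set.Iic t).indicator (fun s => g s (y n)) (τ n))
      = (if t < τ N then g t (x t) else (Set.Iic t).indicator (fun s => g s (y N)) (τ N))
        - ∫ s in Set.Iic t, (Set.Iio (τ N)).indicator (fun s => G s (x s)) s ∂leb := by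
  induction N with
  | zero =>
    simp [h0]
  | succ N ih =>
    -- Nothing is assumed on the measurability of `x`, so measurability before `τ N` is carried
    -- through the induction. It is what allows the integral to be split at `τ N`.
    obtain ⟨ihm, ih⟩ := ih
    have hm : Measurable ((Set.Ico (τ N) (τ (N + 1))).indicator fun s => G s (x s)) := by
      have he : ((Set.Ico (τ N) (τ (N + 1))).indicator fun s => G s (x s))
          = (Set.Ico (τ N) (τ (N + 1))).indicator fun s => G s ((η N).1 (s - τ N)) :=
        Set.indicator_congr fun s hs => by rw [hx N s hs.1 hs.2]
      rw [he]
      refine Measurable.indicator ?_ measurableSet_Ico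
      exact hG.comp (measurable_id.prodMk ((measurable_path (η N)).comp
        (measurable_id.sub_const _)))
    have hadd : ((Set.Iio (τ (N + 1))).indicator fun s => G s (x s))
        = ((Set.Iio (τ N)).indicator fun s => G s (x s))
          + (Set.Ico (τ N) (τ (N + 1))).indicator fun s => G s (x s) := by
      have h := Set.indicator_union_of_disjoint (s := Set.Iio (τ N)) (t := Set.Ico (τ N) (τ (N + 1)))
        (Set.disjoint_left.2 fun s hs hs' => absurd hs'.1 (not_le_of_gt hs)) (fun s => G s (x s))
      rwa [Set.Iio_union_Ico_eq_Iio (hle N)] at h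
    refine ⟨hadd ▸ ihm.add hm, ?_⟩
    rw [Finset.sum_range_succ, ← add_assoc, ih]
    -- Once the horizon has been passed, both new terms vanish and the right-hand side is frozen.
    by_cases ht : t < τ N
    · have e1 : stepValue g G t (((y N, τ N), η N), (y (N + 1), τ (N + 1) - τ N)) = 0 :=
        Set.indicator_of_notMem (by simpa using ht) _
      have e2 : (Set.Iic t).indicator (fun s => g s (y N)) (τ N) = 0 :=
        Set.indicator_of_notMem (by simpa using ht) _
      rw [e1, e2, if_pos ht, if_pos (ht.trans_le (hle N)), sub_self, add_zero]
      congr 1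
      refine setIntegral_congr_fun measurableSet_Iic fun s hs => ?_
      have hs1 : s ∈ Set.Iio (τ N) := lt_of_le_of_lt hs ht
      have hs2 : s ∈ Set.Iio (τ (N + 1)) := hs1.trans_le (hle N)
      simp only [Set.indicator_of_mem hs1, Set.indicator_of_mem hs2]
    · have htN : τ N ≤ t := le_of_not_gt ht
      have hb : ∀ (s : Set ℝ≥0), ∀ v ≤ t, |s.indicator (fun s => G s (x s)) v| ≤ L :=
        fun s v hv => (norm_indicator_le_norm_self (fun s => G s (x s)) v).trans (hL v hv _)
      have e2 : (Set.Iic t).indicator (fun s => g s (y N)) (τ N) = g (τ N) (y N) :=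
        Set.indicator_of_mem (Set.mem_Iic.2 htN) _
      have e3 : ∫ w in Set.Iic (t - τ N),
            (Set.Ioi w).indicator (fun _ => (1 : ℝ)) (τ (N + 1) - τ N)
              * timeShift (τ N) G w ((η N).1 w) ∂leb
          = ∫ s in Set.Iic t, (Set.Ico (τ N) (τ (N + 1))).indicator (fun s => G s (x s)) s ∂leb := by
        rw [setIntegral_Iic_leb_translate _ htN]
        refine integral_congr_ae (ae_of_all _ fun w => ?_)
        by_cases hw : w < τ (N + 1) - τ N
        · have hw' := hx N (τ N + w) le_self_add (lt_tsub_iff_left.1 hw)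
          rw [add_tsub_cancel_left] at hw'
          simp [hw, hw', timeShift]
        · simp [hw]
      have e4 : (Set.Ioi (t - τ N)).indicator (fun _ => (1 : ℝ)) (τ (N + 1) - τ N)
            * timeShift (τ N) g (t - τ N) ((η N).1 (t - τ N))
          + (Set.Iic (t - τ N)).indicator (fun v => timeShift (τ N) g v (y (N + 1)))
            (τ (N + 1) - τ N)
          = if t < τ (N + 1) then g t (x t)
            else (Set.Iic t).indicator (fun s => g s (y (N + 1))) (τ (N + 1)) := by
        -- Either the horizon falls inside this excursion and the increment ends at `x t`, or the
        -- jump comes no later than `t` and it ends at the new state.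
        by_cases h : t < τ (N + 1)
        · have h' : t - τ N < τ (N + 1) - τ N := tsub_lt_tsub_right_of_le htN h
          rw [if_pos h, Set.indicator_of_mem (Set.mem_Ioi.2 h'),
            Set.indicator_of_notMem (show _ ∉ Set.Iic _ from not_le_of_gt h'), hx N t htN h, timeShift,
            add_tsub_cancel_of_le htN]
          ring
        · have h' : τ (N + 1) - τ N ≤ t - τ N := tsub_le_tsub_right (le_of_not_gt h) _
          rw [if_neg h, Set.indicator_of_mem (Set.mem_Iic.2 h'),
            Set.indicator_of_notMem (show _ ∉ Set.Ioi _ from not_lt_of_ge h'),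
            Set.indicator_of_mem (Set.mem_Iic.2 (le_of_not_gt h))]
          simp only [timeShift]
          rw [add_tsub_cancel_of_le (hle N)]
          ring
      have e1 : stepValue g G t (((y N, τ N), η N), (y (N + 1), τ (N + 1) - τ N))
          = (if t < τ (N + 1) then g t (x t)
            else (Set.Iic t).indicator (fun s => g s (y (N + 1))) (τ (N + 1)))
          - ∫ s in Set.Iic t, (Set.Ico (τ N) (τ (N + 1))).indicator (fun s => G s (x s)) s ∂leb := by
        rw [← e3, ← e4]
        exact Set.indicator_of_mem (Set.mem_Iic.2 htN) _
      have e5 : ∫ s in Set.Iic t, (Set.Iio (τ (N + 1))).indicator (fun s => G s (x s)) s ∂leb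
          = (∫ s in Set.Iic t, (Set.Iio (τ N)).indicator (fun s => G s (x s)) s ∂leb)
          + ∫ s in Set.Iic t, (Set.Ico (τ N) (τ (N + 1))).indicator (fun s => G s (x s)) s ∂leb := by
        rw [hadd]
        exact integral_add (integrableOn_Iic_leb_of_bdd ihm t (hb _))
          (integrableOn_Iic_leb_of_bdd hm t (hb _))
      rw [e1, e2, e5, if_neg ht]
      ring

variable {Ω : Type*} [MeasurableSpace Ω] {P : Kernel (State d) (CadlagPath d)}
  {lam : State d → ℝ≥0} {Q : Kernel (State d) (State d)} {μ : Measure (State d)}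
  {Pr : Measure Ω} {ζ : ℕ → Ω → CadlagPath d} {Y : ℕ → Ω → State d} {T : ℕ → Ω → ℝ≥0}
  {X : ℝ≥0 → Ω → State d}

/-- Conditionally on `Yₙ` and `Tₙ ≤ t`, this is the first-jump formula for the functions shifted by
`Tₙ`. The martingale hypothesis is therefore needed for every shift, the random time being fixed by
the conditioning. -/
theorem IsSwitchingConstruction.integral_stepValue [IsProbabilityMeasure Pr] [IsMarkovKernel P]
    [IsMarkovKernel Q] (hS : IsSwitchingConstruction P lam Q μ Pr ζ Y T X)
    (hP : ∀ z, ∀ᵐ ζ ∂(P z), ζ.1 0 = z) (hlam : Measurable lam) {C : ℝ≥0} (hC : ∀ z, lam z ≤ C)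
    (hinf : ∀ z, ∀ᵐ ζ ∂(P z), ∫⁻ v, (lam (ζ.1 v) : ℝ≥0∞) ∂leb = ∞)
    {g a : ℝ≥0 → State d → ℝ} (hg : Measurable (Function.uncurry g)) (hgb : BoundedOnStrips g)
    (ha : Measurable (Function.uncurry a)) (hab : BoundedOnStrips a)
    (hmart : ∀ s z, Martingale (compensated (timeShift s g) (timeShift s a)) (pathFiltration d)
      (P z)) (t : ℝ≥0) (n : ℕ) :
    ∫ ω, stepValue g (switchedGenerator lam Q g a) t
        (((Y n ω, T n ω), ζ n ω), (Y (n + 1) ω, T (n + 1) ω - T n ω)) ∂Pr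
      = ∫ ω, (Set.Iic t).indicator (fun s => g s (Y n ω)) (T n ω) ∂Pr := by
  obtain ⟨K, hK⟩ := hgb t
  obtain ⟨L, hL⟩ := boundedOnStrips_switchedGenerator (Q := Q) hC hg hgb hab t
  have hG := measurable_switchedGenerator (Q := Q) hlam hg hgb ha
  have hm := measurable_stepValue hg hG t
  have hi : Integrable (fun ω => stepValue g (switchedGenerator lam Q g a) t
      (((Y n ω, T n ω), ζ n ω), (Y (n + 1) ω, T (n + 1) ω - T n ω))) Pr := by
    refine Integrable.of_bound (hm.comp ?_).aestronglyMeasurable _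
      (ae_of_all _ fun ω => abs_stepValue_le hK hL _)
    exact ((((hS.measurable_state n).prodMk (hS.measurable_time n)).prodMk
      (hS.measurable_path n)).prodMk ((hS.measurable_state (n + 1)).prodMk
      ((hS.measurable_time (n + 1)).sub (hS.measurable_time n))))
  have hshift : ∀ {f : ℝ≥0 → State d → ℝ}, Measurable (Function.uncurry f) → ∀ s,
      Measurable (Function.uncurry (timeShift s f)) := fun {f} hf s =>
    hf.comp ((measurable_fst.const_add s).prodMk measurable_snd)
  have hshiftb : ∀ {f : ℝ≥0 → State d → ℝ}, BoundedOnStrips f → ∀ s,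
      BoundedOnStrips (timeShift s f) := fun {f} hf s r => by
    obtain ⟨B, hB⟩ := hf (s + r)
    exact ⟨B, fun u hu z => hB _ (by gcongr) z⟩
  rw [hS.integral_step n hm hi]
  refine integral_congr_ae (ae_of_all _ fun ω => ?_)
  by_cases hT : T n ω ∈ Set.Iic t
  · simp only [stepValue, Set.indicator_of_mem hT]
    have h := integral_jumpIncrement (Q := Q) hlam hC (hP (Y n ω)) (hinf (Y n ω))
      (hshift hg (T n ω)) (hshiftb hgb _) (hshift ha (T n ω)) (hshiftb hab _)
      (hmart (T n ω) (Y n ω)) (t - T n ω)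
    -- Shifting in time commutes with forming the switched generator by definition, since `λ` and
    -- `Q` do not depend on time.
    refine h.trans ?_
    rw [timeShift, add_zero]
  · simp only [stepValue, Set.indicator_of_notMem hT, integral_zero]

/-- Dynkin's formula for the switching process, started from the initial state `Y₀`. -/
theorem IsSwitchingConstruction.integral_sub_eq [IsProbabilityMeasure Pr] [IsMarkovKernel P]
    [IsMarkovKernel Q] (hS : IsSwitchingConstruction P lam Q μ Pr ζ Y T X)
    (hP : ∀ z, ∀ᵐ ζ ∂(P z), ζ.1 0 = z) (hlam : Measurable lam) {C : ℝ≥0} (hC : ∀ z, lam z ≤ C)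
    (hinf : ∀ z, ∀ᵐ ζ ∂(P z), ∫⁻ v, (lam (ζ.1 v) : ℝ≥0∞) ∂leb = ∞)
    {g a : ℝ≥0 → State d → ℝ} (hg : Measurable (Function.uncurry g)) (hgb : BoundedOnStrips g)
    (ha : Measurable (Function.uncurry a)) (hab : BoundedOnStrips a)
    (hmart : ∀ s z, Martingale (compensated (timeShift s g) (timeShift s a)) (pathFiltration d)
      (P z)) (t : ℝ≥0) :
    ∫ ω, (g t (X t ω) - ∫ s in Set.Iic t, switchedGenerator lam Q g a s (X s ω) ∂leb) ∂Pr
      = ∫ ω, g 0 (Y 0 ω) ∂Pr := by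
  set G := switchedGenerator lam Q g a
  obtain ⟨K, hK⟩ := hgb t
  obtain ⟨L, hL⟩ := boundedOnStrips_switchedGenerator (Q := Q) hC hg hgb hab t
  have hK0 : 0 ≤ K := (abs_nonneg _).trans (hK t le_rfl 0)
  have hG : Measurable (Function.uncurry G) :=
    measurable_switchedGenerator (Q := Q) hlam hg hgb ha
  let Z : ℕ → Ω → ℝ := fun n ω =>
    stepValue g G t (((Y n ω, T n ω), ζ n ω), (Y (n + 1) ω, T (n + 1) ω - T n ω))
  let W : ℕ → Ω → ℝ := fun n ω => (Set.Iic t).indicator (fun s => g s (Y n ω)) (T n ω)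
  let R : ℕ → Ω → ℝ := fun N ω => g 0 (Y 0 ω) + ∑ n ∈ Finset.range N, (Z n ω - W n ω)
  have iY : Integrable (fun ω => g 0 (Y 0 ω)) Pr :=
    Integrable.of_bound (hg.comp (measurable_const.prodMk
      (hS.measurable_state 0))).aestronglyMeasurable K (ae_of_all _ fun ω => hK 0 zero_le _)
  have iZ : ∀ n, Integrable (Z n) Pr := fun n => by
    refine Integrable.of_bound ((measurable_stepValue hg hG t).comp ?_).aestronglyMeasurable _
      (ae_of_all _ fun ω => abs_stepValue_le hK hL _)
    exact ((((hS.measurable_state n).prodMk (hS.measurable_time n)).prodMk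
      (hS.measurable_path n)).prodMk ((hS.measurable_state (n + 1)).prodMk
      ((hS.measurable_time (n + 1)).sub (hS.measurable_time n))))
  have hW : ∀ n ω, |W n ω| ≤ K := fun n ω => by
    by_cases h : T n ω ∈ Set.Iic t
    · simp only [W, Set.indicator_of_mem h]
      exact hK _ h _
    · simp only [W, Set.indicator_of_notMem h, abs_zero]
      exact hK0
  have iW : ∀ n, Integrable (W n) Pr := fun n => by
    refine Integrable.of_bound (Measurable.aestronglyMeasurable ?_) K (ae_of_all _ (hW n))
    exact Measurable.indicator (s := {ω | T n ω ≤ t})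
      (hg.comp ((hS.measurable_time n).prodMk (hS.measurable_state n)))
      (measurableSet_le (hS.measurable_time n) measurable_const)
  have iS : ∀ N, Integrable (fun ω => ∑ n ∈ Finset.range N, (Z n ω - W n ω)) Pr := fun N =>
    integrable_finsetSum _ fun n _ => (iZ n).sub (iW n)
  have hR : ∀ N, ∫ ω, R N ω ∂Pr = ∫ ω, g 0 (Y 0 ω) ∂Pr := fun N => by
    simp only [R]
    rw [integral_add iY (iS N), integral_finsetSum (f := fun n ω => Z n ω - W n ω) _ fun n _ => (iZ n).sub (iW n),
      Finset.sum_eq_zero, add_zero]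
    intro n _
    rw [integral_sub (iZ n) (iW n), sub_eq_zero]
    exact hS.integral_stepValue hP hlam hC hinf hg hgb ha hab hmart t n
  have hform : ∀ᵐ ω ∂Pr, ∀ N, R N ω
      = (if t < T N ω then g t (X t ω) else W N ω)
        - ∫ s in Set.Iic t, (Set.Iio (T N ω)).indicator (fun s => G s (X s ω)) s ∂leb := by
    filter_upwards [hS.initial_time, hS.time_le, hS.between_jumps] with ω h0 hle hx N
    exact (sum_stepValue_eq (y := fun n => Y n ω) (η := fun n => ζ n ω) (τ := fun n => T n ω)
      (x := fun s => X s ω) h0 hle hx hG hL N).2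
  have hlim : Tendsto (fun N => ∫ ω, R N ω ∂Pr) atTop
      (𝓝 (∫ ω, (g t (X t ω) - ∫ s in Set.Iic t, G s (X s ω) ∂leb) ∂Pr)) := by
    -- The dominating constant comes from the telescoped form: one value of `g` and one integral of
    -- `G`. Bounding the summands separately would give a bound growing with `N`.
    refine tendsto_integral_of_dominated_convergence (fun _ => K + L * t)
      (fun N => (iY.add (iS N)).aestronglyMeasurable) (integrable_const _) (fun N => ?_) ?_
    · filter_upwards [hform] with ω hω
      rw [hω N]
      refine (abs_sub _ _).trans (add_le_add ?_ (abs_setIntegral_Iic_leb_le fun s hs => ?_))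
      · split_ifs
        · exact hK t le_rfl _
        · exact hW N ω
      · exact (norm_indicator_le_norm_self (fun s => G s (X s ω)) s).trans (hL s hs _)
    · filter_upwards [hform, hS.time_le, hS.tendsto_time hlam hC] with ω hω hle hT
      obtain ⟨N, hN⟩ := hT t
      refine tendsto_const_nhds.congr' ?_
      filter_upwards [eventually_ge_atTop N] with n hn
      have hn' : t < T n ω :=
        hN.trans_le (monotone_nat_of_le_succ (f := fun n => T n ω) hle hn)
      rw [hω n, if_pos hn']
      congr 1
      refine setIntegral_congr_fun measurableSet_Iic fun s hs => ?_
      exact (Set.indicator_of_mem (Set.mem_Iio.2 (lt_of_le_of_lt hs hn'))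
        (fun s => G s (X s ω))).symm
  simp only [hR] at hlim
  exact tendsto_nhds_unique hlim tendsto_const_nhds

end Telescoping

/-! ### Conclusion: integrability, Fubini, and the initial value. -/

theorem mainTheorem1 {d : ℕ}
    -- the laws of the intrinsic process given its initial state
    (P : Kernel (State d) (CadlagPath d)) [IsMarkovKernel P]
    (hP : ∀ z, ∀ᵐ ζ ∂(P z), ζ.1 0 = z)
    -- the bounded jump rate and the jump kernel
    (lam : State d → ℝ≥0) (hlam : Measurable lam) (hlam_bdd : ∃ C : ℝ≥0, ∀ z, lam z ≤ C)
    (hlam_inf : ∀ z, ∀ᵐ ζ ∂(P z), ∫⁻ v, (lam (ζ.1 v) : ℝ≥0∞) ∂leb = ∞)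
    (Q : Kernel (State d) (State d)) [IsMarkovKernel Q]
    -- the operator `A₀` with domain `D`
    (D : Set (ℝ≥0 → State d → ℝ)) (A₀ : (ℝ≥0 → State d → ℝ) → (ℝ≥0 → State d → ℝ))
    (hD : ∀ g ∈ D, Measurable (Function.uncurry g) ∧ BoundedOnStrips g)
    (hA₀ : ∀ g ∈ D, Measurable (Function.uncurry (A₀ g)) ∧ BoundedOnStrips (A₀ g))
    (hmart : ∀ g ∈ D, ∀ z, Martingale (compensated g (A₀ g)) (pathFiltration d) (P z))
    -- the switching process
    {Ω : Type*} [MeasurableSpace Ω] (Pr : Measure Ω) [IsProbabilityMeasure Pr]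
    (μ : Measure (State d)) (Ψ : ℝ≥0 → Ω → State d)
    (hΨ : IsSwitchingProcess P lam Q μ Ψ Pr)
    -- the test function
    (g : ℝ≥0 → State d → ℝ) (hg : g ∈ D)
    (hshift : ∀ s : ℝ≥0, 0 < s → timeShift s g ∈ D ∧ A₀ (timeShift s g) = timeShift s (A₀ g)) :
    (∀ t, Integrable (fun ω => g t (Ψ t ω)) Pr) ∧
    (∀ s, Integrable (fun ω => switchedGenerator lam Q g (A₀ g) s (Ψ s ω)) Pr) ∧
    (∀ t, IntegrableOn (fun s => ∫ ω, switchedGenerator lam Q g (A₀ g) s (Ψ s ω) ∂Pr)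
      (Set.Iic t) leb) ∧
    ∀ t : ℝ≥0, ∫ ω, g t (Ψ t ω) ∂Pr = ∫ ω, g 0 (Ψ 0 ω) ∂Pr
      + ∫ s in Set.Iic t, (∫ ω, switchedGenerator lam Q g (A₀ g) s (Ψ s ω) ∂Pr) ∂leb := by
  obtain ⟨C, hC⟩ := hlam_bdd
  obtain ⟨ζ, Y, T, hS⟩ := hΨ
  obtain ⟨hgm, hgb⟩ := hD g hg
  obtain ⟨ham, hab⟩ := hA₀ g hg
  set G := switchedGenerator lam Q g (A₀ g)
  have hGm : Measurable (Function.uncurry G) := measurable_switchedGenerator hlam hgm hgb ham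
  have hGb : BoundedOnStrips G := boundedOnStrips_switchedGenerator hC hgm hgb hab
  have hmart' : ∀ s z, Martingale (compensated (timeShift s g) (timeShift s (A₀ g)))
      (pathFiltration d) (P z) := fun s z => by
    -- The shift hypothesis covers only `s > 0`; the shift by `0` is the identity.
    rcases eq_or_ne s 0 with rfl | hs
    · have h0 : ∀ f : ℝ≥0 → State d → ℝ, timeShift 0 f = f := fun f => by
        ext v x; rw [timeShift, zero_add]
      rw [h0, h0]
      exact hmart g hg z
    · obtain ⟨h1, h2⟩ := hshift s (pos_iff_ne_zero.2 hs)
      rw [← h2]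
      exact hmart _ h1 z
  have hT := hS.tendsto_time hlam hC
  have hΨt : ∀ t, AEMeasurable (Ψ t) Pr := fun t => by
    have hm : Measurable (fun ω : Ω => (t, ω)) := measurable_prodMk_left
    -- A fixed time corresponds to the measure carried by the slice `{t} × Ω`, on which almost sure
    -- statements about `ω` lift.
    have hq : Measure.QuasiMeasurePreserving (Prod.snd : ℝ≥0 × Ω → Ω)
        (Pr.map fun ω => (t, ω)) Pr := by
      refine ⟨measurable_snd, ?_⟩
      rw [Measure.map_map measurable_snd hm]
      exact Measure.absolutelyContinuous_of_eq Measure.map_id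
    exact (hS.aemeasurable_of_ae (hq.ae hS.initial_time) (hq.ae hT) (hq.ae hS.time_le)
      (hq.ae hS.between_jumps)).comp_measurable hm
  have hΨm : ∀ t, AEMeasurable (fun p : ℝ≥0 × Ω => Ψ p.1 p.2)
      ((leb.restrict (Set.Iic t)).prod Pr) := fun t => by
    have hq : Measure.QuasiMeasurePreserving (Prod.snd : ℝ≥0 × Ω → Ω)
        ((leb.restrict (Set.Iic t)).prod Pr) Pr := Measure.quasiMeasurePreserving_snd
    exact hS.aemeasurable_of_ae (hq.ae hS.initial_time) (hq.ae hT) (hq.ae hS.time_le)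
      (hq.ae hS.between_jumps)
  have key : ∀ {f : ℝ≥0 → State d → ℝ}, Measurable (Function.uncurry f) → BoundedOnStrips f →
      ∀ t, Integrable (fun ω => f t (Ψ t ω)) Pr := fun {f} hf hfb t => by
    obtain ⟨K, hK⟩ := hfb t
    exact Integrable.of_bound
      (hf.comp_aemeasurable (aemeasurable_const.prodMk (hΨt t))).aestronglyMeasurable K
      (ae_of_all _ fun ω => hK t le_rfl _)
  have hprod : ∀ t, Integrable (Function.uncurry fun (s : ℝ≥0) ω => G s (Ψ s ω))
      ((leb.restrict (Set.Iic t)).prod Pr) := fun t => by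
    obtain ⟨L, hL⟩ := hGb t
    refine Integrable.of_bound
      (hGm.comp_aemeasurable (measurable_fst.aemeasurable.prodMk (hΨm t))).aestronglyMeasurable L ?_
    have hx : (leb.restrict (Set.Iic t)).prod Pr = (leb.prod Pr).restrict (Set.Iic t ×ˢ Set.univ) := by
      rw [← Measure.prod_restrict, Measure.restrict_univ]
    rw [hx]
    exact ae_restrict_of_forall_mem (measurableSet_Iic.prod MeasurableSet.univ) fun p hp =>
      hL _ hp.1 _
  have hdyn : ∀ t, ∫ ω, g t (Ψ t ω) ∂Pr
      = ∫ ω, g 0 (Y 0 ω) ∂Pr + ∫ s in Set.Iic t, (∫ ω, G s (Ψ s ω) ∂Pr) ∂leb := fun t => by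
    have h := hS.integral_sub_eq hP hlam hC hlam_inf hgm hgb ham hab hmart' t
    have hi : Integrable (fun ω => ∫ s in Set.Iic t, G s (Ψ s ω) ∂leb) Pr :=
      (hprod t).integral_prod_right
    rw [integral_sub (key hgm hgb t) hi] at h
    rw [integral_integral_swap (hprod t), ← h]
    ring
  refine ⟨key hgm hgb, key hGm hGb, fun t => (hprod t).integral_prod_left, fun t => ?_⟩
  -- The formula so far starts from `Y₀`. Taking `t = 0` identifies the mean of `g(0, Y₀)` with that
  -- of `g(0, Ψ₀)`, without comparing the two variables directly.
  have h0 := hdyn 0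
  have he : Set.Iic (0 : ℝ≥0) = {0} := by ext x; simp
  rw [he, setIntegral_measure_zero _ (measure_singleton _), add_zero] at h0
  rw [hdyn t, h0]
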